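/- Let $(A,\Delta)$ be an algebraic quantum group over $\mathbb C$: $A$ is an associative, possibly non-unital algebra with non-degenerate product, $\Delta:A\to M(A\otimes A)$ is a coassociative homomorphism into the multiplier algebra such that the four maps $a\otimes a'\mapsto \Delta(a)(1\otimes a')$, $(a\otimes 1)\Delta(a')$, $\Delta(a)(a'\otimes 1)$, $(1\otimes a)\Delta(a')$ are bijections of $A\otimes A$ (a regular multiplier Hopf algebra), and there is a non-zero left invariant functional $\varphi$ on $A$, i.e. $(\iota\otimes\varphi)\Delta(a)=\varphi(a)1$ for all $a$. Fix $\varphi$, let $S$ be the antipode of $A$ and $\psi=\varphi\circ S$. Let $B=\widehat A=\{\varphi(\,\cdot\,c): c\in A\}$ be the dual, with pairing $\langle a,b\rangle=b(a)$, product given by $\langle a,bb'\rangle=\langle\Delta(a),b\otimes b'\rangle$, and antipode $S$ given by $\langle a,S(b)\rangle=\langle S(a),b\rangle$. Pair $B\otimes A$ with $A\otimes B$ by $\langle b\otimes a,a'\otimes b'\rangle=\langle a',b\rangle\langle a,b'\rangle$, and extend this to $M(B\otimes A)\times(A\otimes B)$ by $\langle m,x\triangleright y\rangle=\langle mx,y\rangle$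 and $\langle m,y\triangleleft x\rangle=\langle xm,y\rangle$, where $x\triangleright y$, $y\triangleleft x$ are the elements of $A\otimes B$ with $\langle x',x\triangleright y\rangle=\langle x'x,y\rangle$ and $\langle x',y\triangleleft x\rangle=\langle xx',y\rangle$ for all $x'\in B\otimes A$. Then the antipodes of $A$ and of $B$ exist and are bijective, $\psi$ is a right integral (non-zero, $(\psi\otimes\iota)\Delta(a)=\psi(a)1$), and $B=\{\varphi(c\,\cdot\,):c\in A\}=\{\psi(\,\cdot\,c):c\in A\}$. There is a unique $V\in M(B\otimes A)$ with $\langle V,a\otimes b\rangle=\langle a,b\rangle$ for all $a\in A$, $b\in B$. As a left and as a right multiplier it is given by $$V(b\otimes a)=\sum_{(c)}\varphi(c_{(2)}\,\cdot\,)\otimes S(c_{(1)})a\quad\text{if } b=\varphi(c\,\cdot\,),\qquad (b\otimes a)V=\sum_{(c)}\psi(\,\cdot\,c_{(1)})\otimes aS(c_{(2)})\quad\text{if } b=\psi(\,\cdot\,c).$$ Moreover $(1\otimes a)V(b\otimes 1)$ and $(b\otimes 1)V(1\otimes a)$ lie in $B\otimes A$ for all $a\in A$, $b\in B$, and $(\iota\otimes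 S)V$ and $(S\otimes\iota)V$ are in $M(B\otimes A)$: there are unique $W,W'\in M(B\otimes A)$ such that for all $a\in A$, $b\in B$ $$W(b\otimes S(a))=(\iota\otimes S)\big((1\otimes a)V(b\otimes1)\big),\qquad (b\otimes S(a))W=(\iota\otimes S)\big((b\otimes 1)V(1\otimes a)\big),$$ $$W'(S(b)\otimes a)=(S\otimes\iota)\big((b\otimes1)V(1\otimes a)\big),\qquad (S(b)\otimes a)W'=(S\otimes\iota)\big((1\otimes a)V(b\otimes1)\big),$$ and these satisfy $\langle W,a\otimes b\rangle=\langle a,S(b)\rangle$ and $\langle W',a\otimes b\rangle=\langle S(a),b\rangle$. -/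

import Mathlib

open scoped TensorProduct

set_option linter.unusedSimpArgs false

noncomputable section

/-! ### Multiplier algebras and slices -/

/-- The product of `C` is non-degenerate. -/
def NondegenerateProduct (C : Type*) [NonUnitalRing C] : Prop :=
  (∀ a : C, (∀ b, a * b = 0) → a = 0) ∧ (∀ a : C, (∀ b, b * a = 0) → a = 0)

section Multiplier

variable (C : Type*) [NonUnitalRing C] [Module ℂ C] [IsScalarTower ℂ C C] [SMulCommClass ℂ C C]

/-- The multiplier algebra `M(C)`: pairs `m = (L, R)` of linear maps, `L x = m x` and `R x = x m`,
with `L (x y) = (L x) y`, `R (x y) = x (R y)` and `(R x) y = x (L y)`. The second component lives in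
the opposite algebra, so that `x (m m') = (x m) m'`. -/
def MultiplierAlgebra :
    Subalgebra ℂ (Module.End ℂ C × (Module.End ℂ C)ᵐᵒᵖ) where
  carrier := {p | (∀ x y, p.1 (x * y) = p.1 x * y) ∧
    (∀ x y, p.2.unop (x * y) = x * p.2.unop y) ∧ (∀ x y, p.2.unop x * y = x * p.1 y)}
  mul_mem' := by
    rintro p q ⟨h1, h2, h3⟩ ⟨k1, k2, k3⟩
    refine ⟨fun x y => ?_, fun x y => ?_, fun x y => ?_⟩ <;> simp_all
  add_mem' := by
    rintro p q ⟨h1, h2, h3⟩ ⟨k1, k2, k3⟩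
    refine ⟨fun x y => ?_, fun x y => ?_, fun x y => ?_⟩ <;> simp_all [mul_add, add_mul]
  algebraMap_mem' := by
    intro r
    refine ⟨fun x y => ?_, fun x y => ?_, fun x y => ?_⟩ <;>
      simp [MulOpposite.algebraMap_apply, Module.algebraMap_end_apply, mul_smul_comm,
        smul_mul_assoc]

variable {C}

/-- `m.left x` is the product `m x`. -/
def MultiplierAlgebra.left (m : MultiplierAlgebra C) : C →ₗ[ℂ] C := m.1.1

/-- `m.right x` is the product `x m`. -/
def MultiplierAlgebra.right (m : MultiplierAlgebra C) : C →ₗ[ℂ] C := m.1.2.unop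

namespace MultiplierAlgebra

@[ext] theorem ext' {m n : MultiplierAlgebra C} (h1 : ∀ x, left m x = left n x)
    (h2 : ∀ x, right m x = right n x) : m = n :=
  Subtype.ext (Prod.ext (LinearMap.ext h1) (MulOpposite.unop_injective (LinearMap.ext h2)))

theorem left_mul (m : MultiplierAlgebra C) (x y : C) : left m (x * y) = left m x * y :=
  m.2.1 x y

theorem right_mul (m : MultiplierAlgebra C) (x y : C) : right m (x * y) = x * right m y :=
  m.2.2.1 x y

theorem right_mul_eq (m : MultiplierAlgebra C) (x y : C) : right m x * y = x * left m y :=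
  m.2.2.2 x y

theorem left_mul_apply (m n : MultiplierAlgebra C) (x : C) :
    left (m * n) x = left m (left n x) := rfl

theorem right_mul_apply (m n : MultiplierAlgebra C) (x : C) :
    right (m * n) x = right n (right m x) := rfl

/-- The canonical map `C → M(C)`. -/
def embed : C →ₗ[ℂ] MultiplierAlgebra C where
  toFun c := ⟨(LinearMap.mulLeft ℂ c, MulOpposite.op (LinearMap.mulRight ℂ c)),
    fun x y => by simp [mul_assoc], fun x y => by simp [mul_assoc],
    fun x y => by simp [mul_assoc]⟩
  map_add' x y := by ext z <;> simp [left, right, add_mul, mul_add]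
  map_smul' r x := by ext z <;> simp [left, right, smul_mul_assoc, mul_smul_comm]

@[simp] theorem left_embed (c x : C) : left (embed c) x = c * x := rfl

@[simp] theorem right_embed (c x : C) : right (embed c) x = x * c := rfl

theorem mul_embed (m : MultiplierAlgebra C) (x : C) : m * embed x = embed (left m x) := by
  ext y
  · simp [left_mul_apply, left_mul]
  · simp [right_mul_apply, right_mul_eq]

theorem embed_injective (h : NondegenerateProduct C) :
    Function.Injective (embed : C → MultiplierAlgebra C) := by
  intro x y hxy
  rw [← sub_eq_zero]
  refine h.1 _ fun z => ?_
  have : left (embed x) z = left (embed y) z := by rw [hxy]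
  simpa [sub_mul, sub_eq_zero] using this

section Tensor

variable {D : Type*} [NonUnitalRing D] [Module ℂ D] [IsScalarTower ℂ D D] [SMulCommClass ℂ D D]

/-- The multiplier `c ⊗ 1` of `C ⊗ D`. -/
def inl (c : C) : MultiplierAlgebra (C ⊗[ℂ] D) :=
  ⟨((LinearMap.mulLeft ℂ c).rTensor D, MulOpposite.op ((LinearMap.mulRight ℂ c).rTensor D)), by
    refine ⟨fun x y => ?_, fun x y => ?_, fun x y => ?_⟩ <;>
    induction x with
    | zero => simp
    | add x x' hx hx' => simp_all [add_mul]
    | tmul p q =>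
      induction y with
      | zero => simp
      | add y y' hy hy' => simp_all [mul_add]
      | tmul r s => simp [mul_assoc]⟩

/-- The multiplier `1 ⊗ d` of `C ⊗ D`. -/
def inr (d : D) : MultiplierAlgebra (C ⊗[ℂ] D) :=
  ⟨((LinearMap.mulLeft ℂ d).lTensor C, MulOpposite.op ((LinearMap.mulRight ℂ d).lTensor C)), by
    refine ⟨fun x y => ?_, fun x y => ?_, fun x y => ?_⟩ <;>
    induction x with
    | zero => simp
    | add x x' hx hx' => simp_all [add_mul]
    | tmul p q =>
      induction y with
      | zero => simp
      | add y y' hy hy' => simp_all [mul_add]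
      | tmul r s => simp [mul_assoc]⟩

theorem left_inl (c : C) : left (inl (D := D) c) = (LinearMap.mulLeft ℂ c).rTensor D := rfl
theorem right_inl (c : C) : right (inl (D := D) c) = (LinearMap.mulRight ℂ c).rTensor D := rfl
theorem left_inr (d : D) : left (inr (C := C) d) = (LinearMap.mulLeft ℂ d).lTensor C := rfl
theorem right_inr (d : D) : right (inr (C := C) d) = (LinearMap.mulRight ℂ d).lTensor C := rfl

theorem embed_mul (m : MultiplierAlgebra C) (x : C) : embed x * m = embed (right m x) := by
  ext y
  · simp [left_mul_apply, right_mul_eq]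
  · simp [right_mul_apply, right_mul]

theorem inr_mul_inl (c : C) (d : D) : inr d * inl c = embed (c ⊗ₜ[ℂ] d) := by
  ext y <;> induction y with
  | zero => simp
  | add y y' hy hy' => simp_all [mul_add, add_mul]
  | tmul r s =>
    simp [left_mul_apply, right_mul_apply, left_inl, left_inr, right_inl, right_inr]

end Tensor

end MultiplierAlgebra

end Multiplier

section Slice

variable {V W : Type*} [AddCommGroup V] [Module ℂ V] [AddCommGroup W] [Module ℂ W]

/-- The slice map `ι ⊗ ω : V ⊗ W → V`. -/
def sliceRight (ω : W →ₗ[ℂ] ℂ) : V ⊗[ℂ] W →ₗ[ℂ] V :=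
  (TensorProduct.rid ℂ V).toLinearMap ∘ₗ ω.lTensor V

/-- The slice map `ω ⊗ ι : V ⊗ W → W`. -/
def sliceLeft (ω : V →ₗ[ℂ] ℂ) : V ⊗[ℂ] W →ₗ[ℂ] W :=
  (TensorProduct.lid ℂ W).toLinearMap ∘ₗ ω.rTensor W

@[simp] theorem sliceRight_tmul (ω : W →ₗ[ℂ] ℂ) (v : V) (w : W) :
    sliceRight ω (v ⊗ₜ[ℂ] w) = ω w • v := by simp [sliceRight]

@[simp] theorem sliceLeft_tmul (ω : V →ₗ[ℂ] ℂ) (v : V) (w : W) :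
    sliceLeft ω (v ⊗ₜ[ℂ] w) = ω v • w := by simp [sliceLeft]

theorem eq_zero_of_sliceRight (z : V ⊗[ℂ] W)
    (h : ∀ ω : W →ₗ[ℂ] ℂ, sliceRight ω z = 0) : z = 0 := by
  classical
  let b := Module.Basis.ofVectorSpace ℂ W
  apply (TensorProduct.equivFinsuppOfBasisRight (M := V) b).injective
  ext i
  rw [map_zero, Finsupp.zero_apply, ← h (b.coord i)]
  clear h
  induction z with
  | zero => simp
  | add x y hx hy => simp_all
  | tmul v w => simp [smul_mul_assoc, mul_smul_comm]

theorem eq_zero_of_sliceLeft (z : V ⊗[ℂ] W)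
    (h : ∀ ω : V →ₗ[ℂ] ℂ, sliceLeft ω z = 0) : z = 0 := by
  apply (TensorProduct.comm ℂ V W).injective
  rw [map_zero]
  refine eq_zero_of_sliceRight _ fun ω => ?_
  rw [← h ω]
  clear h
  induction z with
  | zero => simp
  | add x y hx hy => simp_all
  | tmul v w => simp [smul_mul_assoc, mul_smul_comm]

end Slice

/-- The tensor product of non-degenerate algebras is non-degenerate. -/
theorem NondegenerateProduct.tensor {C D : Type*}
    [NonUnitalRing C] [Module ℂ C] [IsScalarTower ℂ C C] [SMulCommClass ℂ C C]
    [NonUnitalRing D] [Module ℂ D] [IsScalarTower ℂ D D] [SMulCommClass ℂ D D]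
    (hC : NondegenerateProduct C) (hD : NondegenerateProduct D) :
    NondegenerateProduct (C ⊗[ℂ] D) := by
  constructor
  · intro z hz
    refine eq_zero_of_sliceLeft z fun ω => hD.1 _ fun d => ?_
    have h1 : (LinearMap.mulRight ℂ d).lTensor C z = 0 := by
      refine eq_zero_of_sliceRight _ fun θ => hC.1 _ fun c => ?_
      have h2 : sliceRight θ ((LinearMap.mulRight ℂ d).lTensor C z) * c
          = sliceRight θ (z * (c ⊗ₜ[ℂ] d)) := by
        clear hz
        induction z with
        | zero => simp
        | add x y hx hy => simp_all [add_mul]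
        | tmul v w => simp [smul_mul_assoc, mul_smul_comm]
      rw [h2, hz, map_zero]
    have h3 : sliceLeft ω z * d = sliceLeft ω ((LinearMap.mulRight ℂ d).lTensor C z) := by
      clear hz h1
      induction z with
      | zero => simp
      | add x y hx hy => simp_all [add_mul]
      | tmul v w => simp [smul_mul_assoc, mul_smul_comm]
    rw [h3, h1, map_zero]
  · intro z hz
    refine eq_zero_of_sliceLeft z fun ω => hD.2 _ fun d => ?_
    have h1 : (LinearMap.mulLeft ℂ d).lTensor C z = 0 := by
      refine eq_zero_of_sliceRight _ fun θ => hC.2 _ fun c => ?_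
      have h2 : c * sliceRight θ ((LinearMap.mulLeft ℂ d).lTensor C z)
          = sliceRight θ ((c ⊗ₜ[ℂ] d) * z) := by
        clear hz
        induction z with
        | zero => simp
        | add x y hx hy => simp_all [mul_add]
        | tmul v w => simp [smul_mul_assoc, mul_smul_comm]
      rw [h2, hz, map_zero]
    have h3 : d * sliceLeft ω z = sliceLeft ω ((LinearMap.mulLeft ℂ d).lTensor C z) := by
      clear hz h1
      induction z with
      | zero => simp
      | add x y hx hy => simp_all [mul_add]
      | tmul v w => simp [smul_mul_assoc, mul_smul_comm]
    rw [h3, h1, map_zero]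

/-! ### Regular multiplier Hopf algebras and algebraic quantum groups -/

open MultiplierAlgebra

/-- Coassociativity, covered from both sides:
`(a ⊗ 1 ⊗ 1)(Δ ⊗ ι)(Δ(b)(1 ⊗ c)) = (ι ⊗ Δ)((a ⊗ 1)Δ(b))(1 ⊗ 1 ⊗ c)`,
where `T (a ⊗ b) = Δ(a)(1 ⊗ b)` and `T' (a ⊗ b) = (a ⊗ 1)Δ(b)`. -/
def Coassociative {A : Type*} [AddCommGroup A] [Module ℂ A]
    (T T' : A ⊗[ℂ] A →ₗ[ℂ] A ⊗[ℂ] A) : Prop :=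
  ∀ a b c : A,
    TensorProduct.assoc ℂ A A A
        (T'.rTensor A ((TensorProduct.assoc ℂ A A A).symm (a ⊗ₜ[ℂ] T (b ⊗ₜ[ℂ] c))))
      = T.lTensor A (TensorProduct.assoc ℂ A A A (T' (a ⊗ₜ[ℂ] b) ⊗ₜ[ℂ] c))

/-- A regular multiplier Hopf algebra over `ℂ`: a non-degenerate algebra `A` with a homomorphism
`Δ : A → M(A ⊗ A)` such that both `Δ` and the flipped coproduct `Δ^cop` are coassociative and have
canonical maps that are bijections of `A ⊗ A`. The four canonical maps are determined by `Δ`. -/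
structure RegularMultiplierHopfAlgebra (A : Type*) [NonUnitalRing A] [Module ℂ A]
    [IsScalarTower ℂ A A] [SMulCommClass ℂ A A] where
  nondegenerate : NondegenerateProduct A
  comul : A →ₙₐ[ℂ] MultiplierAlgebra (A ⊗[ℂ] A)
  /-- `a ⊗ b ↦ Δ(a)(1 ⊗ b)` -/
  T₁ : A ⊗[ℂ] A ≃ₗ[ℂ] A ⊗[ℂ] A
  /-- `a ⊗ b ↦ (a ⊗ 1)Δ(b)` -/
  T₂ : A ⊗[ℂ] A ≃ₗ[ℂ] A ⊗[ℂ] A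
  /-- `a ⊗ b ↦ Δ(a)(b ⊗ 1)` -/
  T₃ : A ⊗[ℂ] A ≃ₗ[ℂ] A ⊗[ℂ] A
  /-- `a ⊗ b ↦ (1 ⊗ a)Δ(b)` -/
  T₄ : A ⊗[ℂ] A ≃ₗ[ℂ] A ⊗[ℂ] A
  embed_T₁ : ∀ a b, embed (T₁ (a ⊗ₜ b)) = comul a * inr b
  embed_T₂ : ∀ a b, embed (T₂ (a ⊗ₜ b)) = inl a * comul b
  embed_T₃ : ∀ a b, embed (T₃ (a ⊗ₜ b)) = comul a * inl b
  embed_T₄ : ∀ a b, embed (T₄ (a ⊗ₜ b)) = inr a * comul b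
  coassoc : Coassociative T₁.toLinearMap T₂.toLinearMap
  coassoc_cop : Coassociative
    ((TensorProduct.comm ℂ A A).toLinearMap ∘ₗ T₃.toLinearMap)
    ((TensorProduct.comm ℂ A A).toLinearMap ∘ₗ T₄.toLinearMap)

namespace RegularMultiplierHopfAlgebra

variable {A : Type*} [NonUnitalRing A] [Module ℂ A] [IsScalarTower ℂ A A] [SMulCommClass ℂ A A]

/-- `ε` is the counit:
`(ε ⊗ ι)(Δ(a)(1 ⊗ b)) = ab` and `(ι ⊗ ε)((a ⊗ 1)Δ(b)) = ab`. -/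
def IsCounit (H : RegularMultiplierHopfAlgebra A) (ε : A →ₗ[ℂ] ℂ) : Prop :=
  (∀ a b, sliceLeft ε (H.T₁ (a ⊗ₜ b)) = a * b) ∧ (∀ a b, sliceRight ε (H.T₂ (a ⊗ₜ b)) = a * b)

/-- `S` is the antipode: with `ε` the counit and `m` the product map,
`m(S ⊗ ι)(Δ(a)(1 ⊗ b)) = ε(a)b` and `m(ι ⊗ S)((a ⊗ 1)Δ(b)) = ε(b)a`. -/
def IsAntipode (H : RegularMultiplierHopfAlgebra A) (S : A ≃ₗ[ℂ] A) : Prop :=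
  ∃ ε, H.IsCounit ε ∧
    (∀ a b, LinearMap.mul' ℂ A (S.toLinearMap.rTensor A (H.T₁ (a ⊗ₜ b))) = ε a • b) ∧
    (∀ a b, LinearMap.mul' ℂ A (S.toLinearMap.lTensor A (H.T₂ (a ⊗ₜ b))) = ε b • a)

/-- The antipode of `A`. -/
def antipode (H : RegularMultiplierHopfAlgebra A) : A ≃ₗ[ℂ] A :=
  Classical.epsilon H.IsAntipode

/-- A left integral: a non-zero functional with `(ι ⊗ φ)Δ(a) = φ(a)1` in `M(A)`, both as a left and
as a right multiplier. -/
def IsLeftIntegral (H : RegularMultiplierHopfAlgebra A) (φ : A →ₗ[ℂ] ℂ) : Prop :=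
  φ ≠ 0 ∧ (∀ a b, sliceRight φ (H.T₃ (a ⊗ₜ b)) = φ a • b) ∧
    (∀ a b, sliceRight φ (H.T₂ (b ⊗ₜ a)) = φ a • b)

/-- A right integral: a non-zero functional with `(ψ ⊗ ι)Δ(a) = ψ(a)1` in `M(A)`, both as a left and
as a right multiplier. -/
def IsRightIntegral (H : RegularMultiplierHopfAlgebra A) (ψ : A →ₗ[ℂ] ℂ) : Prop :=
  ψ ≠ 0 ∧ (∀ a b, sliceLeft ψ (H.T₁ (a ⊗ₜ b)) = ψ a • b) ∧
    (∀ a b, sliceLeft ψ (H.T₄ (b ⊗ₜ a)) = ψ a • b)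

end RegularMultiplierHopfAlgebra

/-- An algebraic quantum group, with a fixed left integral `φ`. -/
structure AlgebraicQuantumGroup (A : Type*) [NonUnitalRing A] [Module ℂ A]
    [IsScalarTower ℂ A A] [SMulCommClass ℂ A A] extends RegularMultiplierHopfAlgebra A where
  φ : A →ₗ[ℂ] ℂ
  isLeftIntegral_φ : toRegularMultiplierHopfAlgebra.IsLeftIntegral φ

namespace AlgebraicQuantumGroup

variable {A : Type*} [NonUnitalRing A] [Module ℂ A] [IsScalarTower ℂ A A] [SMulCommClass ℂ A A]

/-- The antipode `S` of `A`. -/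
def S (G : AlgebraicQuantumGroup A) : A ≃ₗ[ℂ] A := G.toRegularMultiplierHopfAlgebra.antipode

/-- The right integral `ψ = φ ∘ S`. -/
def ψ (G : AlgebraicQuantumGroup A) : A →ₗ[ℂ] ℂ := G.φ ∘ₗ G.S.toLinearMap

/-- `c ↦ f(· c)` -/
def mulRightFunctional (f : A →ₗ[ℂ] ℂ) : A →ₗ[ℂ] (A →ₗ[ℂ] ℂ) :=
  ((LinearMap.mul ℂ A).compr₂ f).flip

/-- `c ↦ f(c ·)` -/
def mulLeftFunctional (f : A →ₗ[ℂ] ℂ) : A →ₗ[ℂ] (A →ₗ[ℂ] ℂ) :=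
  (LinearMap.mul ℂ A).compr₂ f

@[simp] theorem mulRightFunctional_apply (f : A →ₗ[ℂ] ℂ) (c x : A) :
    mulRightFunctional f c x = f (x * c) := rfl

@[simp] theorem mulLeftFunctional_apply (f : A →ₗ[ℂ] ℂ) (c x : A) :
    mulLeftFunctional f c x = f (c * x) := rfl

/-- The underlying space of the dual: the functionals `φ(· c)` with `c ∈ A`. -/
def dualSubmodule (G : AlgebraicQuantumGroup A) : Submodule ℂ (A →ₗ[ℂ] ℂ) :=
  LinearMap.range (mulRightFunctional G.φ)

/-- The dual `B = Â`; its product is defined below. -/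
def Dual (G : AlgebraicQuantumGroup A) : Type _ := G.dualSubmodule

variable (G : AlgebraicQuantumGroup A)

instance : AddCommGroup G.Dual := inferInstanceAs (AddCommGroup G.dualSubmodule)

instance : Module ℂ G.Dual := inferInstanceAs (Module ℂ G.dualSubmodule)

/-- The inclusion of `B` in the space of functionals on `A`. -/
def toFunctional : G.Dual →ₗ[ℂ] (A →ₗ[ℂ] ℂ) := G.dualSubmodule.subtype

/-- The canonical pairing `⟨a, b⟩` of `A` with `B`: evaluation of `b` in `a`. -/
def pair (a : A) (b : G.Dual) : ℂ := G.toFunctional b a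

theorem toFunctional_injective : Function.Injective G.toFunctional :=
  Subtype.val_injective

theorem exists_repr (b : G.Dual) : ∃ c, mulRightFunctional G.φ c = G.toFunctional b := b.2

/-- The left action `b ▷ a = (ι ⊗ b)Δ(a)`, that is `(ι ⊗ φ)(Δ(a)(1 ⊗ c))` for `b = φ(· c)`. -/
def act (b : G.Dual) : A →ₗ[ℂ] A :=
  sliceRight G.φ ∘ₗ G.T₁.toLinearMap ∘ₗ
    (TensorProduct.mk ℂ A A).flip (G.exists_repr b).choose

/-- The action does not depend on the choice of `c`. -/
theorem mul_act (b : G.Dual) (x a : A) :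
    x * G.act b a = sliceRight (G.toFunctional b) (G.T₂ (x ⊗ₜ a)) := by
  rw [← (G.exists_repr b).choose_spec]
  change x * sliceRight G.φ (G.T₁ (a ⊗ₜ[ℂ] (G.exists_repr b).choose)) = _
  generalize (G.exists_repr b).choose = c
  have h1 : (LinearMap.mulLeft ℂ x).rTensor A (G.T₁ (a ⊗ₜ[ℂ] c))
      = (LinearMap.mulRight ℂ c).lTensor A (G.T₂ (x ⊗ₜ[ℂ] a)) := by
    apply embed_injective (G.nondegenerate.tensor G.nondegenerate)
    rw [← left_inl, ← right_inr, ← mul_embed, ← embed_mul, G.embed_T₁, G.embed_T₂, mul_assoc]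
  have h2 : ∀ z : A ⊗[ℂ] A, x * sliceRight G.φ z
      = sliceRight G.φ ((LinearMap.mulLeft ℂ x).rTensor A z) := by
    intro z
    induction z with
    | zero => simp
    | add x y hx hy => simp_all [mul_add]
    | tmul v w => simp [smul_mul_assoc, mul_smul_comm]
  have h3 : ∀ z : A ⊗[ℂ] A, sliceRight (mulRightFunctional G.φ c) z
      = sliceRight G.φ ((LinearMap.mulRight ℂ c).lTensor A z) := by
    intro z
    induction z with
    | zero => simp
    | add x y hx hy => simp_all
    | tmul v w => simp [smul_mul_assoc, mul_smul_comm]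
  rw [h2, h1, h3]

theorem eq_of_mul_left (G : AlgebraicQuantumGroup A) {x y : A} (h : ∀ z, z * x = z * y) : x = y := by
  rw [← sub_eq_zero]
  exact G.nondegenerate.2 _ fun z => by rw [mul_sub, h, sub_self]

/-- The functional `a ↦ ⟨Δ(a), b ⊗ b'⟩ = ⟨b' ▷ a, b⟩` lies in the dual. -/
theorem mul_mem (b b' : G.Dual) : G.toFunctional b ∘ₗ G.act b' ∈ G.dualSubmodule := by
  obtain ⟨c, hc⟩ := G.exists_repr b
  set c' := (G.exists_repr b').choose with hc'
  refine ⟨sliceRight G.φ (G.T₃.symm (c ⊗ₜ[ℂ] c')), LinearMap.ext fun a => ?_⟩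
  rw [← hc]
  change G.φ (a * sliceRight G.φ (G.T₃.symm (c ⊗ₜ[ℂ] c')))
    = G.φ (sliceRight G.φ (G.T₁ (a ⊗ₜ[ℂ] c')) * c)
  have h1 : (LinearMap.mulRight ℂ c).rTensor A (G.T₁ (a ⊗ₜ[ℂ] c'))
      = left (G.comul a) (c ⊗ₜ[ℂ] c') := by
    apply embed_injective (G.nondegenerate.tensor G.nondegenerate)
    rw [← right_inl, ← embed_mul, ← mul_embed, G.embed_T₁, mul_assoc, inr_mul_inl]
  have h2 : ∀ z : A ⊗[ℂ] A, sliceRight G.φ z * c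
      = sliceRight G.φ ((LinearMap.mulRight ℂ c).rTensor A z) := by
    intro z
    induction z with
    | zero => simp
    | add x y hx hy => simp_all [add_mul]
    | tmul v w => simp [smul_mul_assoc, mul_smul_comm]
  have h3 : ∀ z : A ⊗[ℂ] A, left (G.comul a) (G.T₃ z)
      = G.T₃ ((LinearMap.mulLeft ℂ a).rTensor A z) := by
    intro z
    induction z with
    | zero => simp
    | add x y hx hy => simp_all
    | tmul v w =>
      apply embed_injective (G.nondegenerate.tensor G.nondegenerate)
      rw [← mul_embed, LinearMap.rTensor_tmul, G.embed_T₃, G.embed_T₃, LinearMap.mulLeft_apply,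
        map_mul, mul_assoc]
  rw [h2, h1]
  obtain ⟨z, hz⟩ : ∃ z, G.T₃ z = c ⊗ₜ[ℂ] c' := G.T₃.surjective _
  rw [← hz, h3, LinearEquiv.symm_apply_apply]
  clear hz
  induction z with
  | zero => simp
  | add x y hx hy => simp_all [mul_add]
  | tmul v w =>
    rw [LinearMap.rTensor_tmul, G.isLeftIntegral_φ.2.1]
    simp [mul_smul_comm, mul_comm]

/-- The product of `B`: `⟨a, b b'⟩ = ⟨Δ(a), b ⊗ b'⟩ = ⟨b' ▷ a, b⟩`. -/
instance : Mul G.Dual := ⟨fun b b' => ⟨G.toFunctional b ∘ₗ G.act b', G.mul_mem b b'⟩⟩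

theorem toFunctional_mul (b b' : G.Dual) (a : A) :
    G.toFunctional (b * b') a = G.toFunctional b (G.act b' a) := rfl

theorem act_mul (b b' : G.Dual) (a : A) : G.act (b * b') a = G.act b (G.act b' a) := by
  have h1 : ∀ z : A ⊗[ℂ] A, sliceRight (G.toFunctional (b * b')) z
      = sliceRight (G.toFunctional b) ((G.act b').lTensor A z) := by
    intro z
    induction z with
    | zero => simp
    | add x y hx hy => simp_all
    | tmul v w => simp [toFunctional_mul]
  refine G.eq_of_mul_left fun x => ?_
  rw [mul_act, mul_act, h1]
  congr 1
  set c := (G.exists_repr b').choose with hc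
  have hact : ∀ q, G.act b' q = sliceRight G.φ (G.T₁ (q ⊗ₜ[ℂ] c)) := fun q => rfl
  have h2 : ∀ z : A ⊗[ℂ] A, (G.act b').lTensor A z
      = (sliceRight G.φ).lTensor A (G.T₁.toLinearMap.lTensor A
          (TensorProduct.assoc ℂ A A A (z ⊗ₜ[ℂ] c))) := by
    intro z
    induction z with
    | zero => simp
    | add x y hx hy => simp_all [TensorProduct.add_tmul]
    | tmul v w => simp [hact]
  have h3 : ∀ z : A ⊗[ℂ] A, (sliceRight G.φ).lTensor A (TensorProduct.assoc ℂ A A A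
        (G.T₂.toLinearMap.rTensor A ((TensorProduct.assoc ℂ A A A).symm (x ⊗ₜ[ℂ] z))))
      = G.T₂ (x ⊗ₜ[ℂ] sliceRight G.φ z) := by
    intro z
    induction z with
    | zero => simp
    | add x y hx hy => simp_all [TensorProduct.tmul_add]
    | tmul v w =>
      have h4 : ∀ y : A ⊗[ℂ] A, (sliceRight G.φ).lTensor A
          (TensorProduct.assoc ℂ A A A (y ⊗ₜ[ℂ] w)) = G.φ w • y := by
        intro y
        induction y with
        | zero => simp
        | add x y hx hy => simp_all [TensorProduct.add_tmul]
        | tmul p q => simp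
      simp [h4]
  rw [h2, hact, ← h3]
  exact congrArg _ (G.coassoc x a c).symm

theorem act_add (b b' : G.Dual) (a : A) : G.act (b + b') a = G.act b a + G.act b' a := by
  refine G.eq_of_mul_left fun x => ?_
  rw [mul_add, mul_act, mul_act, mul_act]
  simp [sliceRight, LinearMap.lTensor_add]

theorem act_smul (r : ℂ) (b : G.Dual) (a : A) : G.act (r • b) a = r • G.act b a := by
  refine G.eq_of_mul_left fun x => ?_
  rw [mul_smul_comm, mul_act, mul_act]
  simp [sliceRight, LinearMap.lTensor_smul]

theorem dual_ext {b b' : G.Dual} (h : ∀ a, G.toFunctional b a = G.toFunctional b' a) :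
    b = b' := G.toFunctional_injective (LinearMap.ext h)

instance : NonUnitalRing G.Dual where
  left_distrib x y z := G.dual_ext fun a => by simp [toFunctional_mul, act_add]
  right_distrib x y z := G.dual_ext fun a => by simp [toFunctional_mul]
  zero_mul x := G.dual_ext fun a => by simp [toFunctional_mul]
  mul_zero x := G.dual_ext fun a => by
    have h : G.act 0 a = 0 := by simpa using G.act_add 0 0 a
    simp [toFunctional_mul, h]
  mul_assoc x y z := G.dual_ext fun a => by simp [toFunctional_mul, act_mul]

instance : IsScalarTower ℂ G.Dual G.Dual where
  smul_assoc r x y := G.dual_ext fun a => by simp [toFunctional_mul, smul_eq_mul]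

instance : SMulCommClass ℂ G.Dual G.Dual where
  smul_comm r x y := G.dual_ext fun a => by simp [toFunctional_mul, act_smul, smul_eq_mul]

/-- `S` is the antipode of the dual, the transpose of the antipode of `A`:
`⟨a, S(b)⟩ = ⟨S(a), b⟩`. -/
def IsDualAntipode (S' : G.Dual ≃ₗ[ℂ] G.Dual) : Prop :=
  ∀ a b, G.pair a (S' b) = G.pair (G.S a) b

/-- The antipode of the dual `B`. -/
def dualS : G.Dual ≃ₗ[ℂ] G.Dual := Classical.epsilon G.IsDualAntipode

end AlgebraicQuantumGroup

/-! ### Extended pairings and the duality -/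

/-- Let `p` be a pairing of an algebra `C` with a space `D`. The functional `f` on `D` is the extended
pairing `⟨m, ·⟩` with the multiplier `m ∈ M(C)`: `⟨m, x ▷ y⟩ = ⟨mx, y⟩` and `⟨m, y ◁ x⟩ = ⟨xm, y⟩`.
Here `x ▷ y` and `y ◁ x` are the elements of `D` with
`⟨x', x ▷ y⟩ = ⟨x'x, y⟩` and `⟨x', y ◁ x⟩ = ⟨xx', y⟩` for all `x'`. -/
def IsExtendedPairing {C D : Type*} [NonUnitalRing C] [Module ℂ C] [IsScalarTower ℂ C C]
    [SMulCommClass ℂ C C] [AddCommGroup D] [Module ℂ D] (p : C →ₗ[ℂ] D →ₗ[ℂ] ℂ)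
    (m : MultiplierAlgebra C) (f : D →ₗ[ℂ] ℂ) : Prop :=
  (∀ (x : C) (y y' : D), (∀ x', p x' y' = p (x' * x) y) → f y' = p (left m x) y) ∧
  (∀ (x : C) (y y' : D), (∀ x', p x' y' = p (x * x') y) → f y' = p (right m x) y)

namespace AlgebraicQuantumGroup

variable {A : Type*} [NonUnitalRing A] [Module ℂ A] [IsScalarTower ℂ A A] [SMulCommClass ℂ A A]
variable (G : AlgebraicQuantumGroup A)

/-- The functional `a ⊗ b ↦ ⟨a, b⟩` on `A ⊗ B`. -/
def evaluation : A ⊗[ℂ] G.Dual →ₗ[ℂ] ℂ := TensorProduct.lift G.toFunctional.flip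

/-- The pairing of `B ⊗ A` with `A ⊗ B`: `⟨b ⊗ a, a' ⊗ b'⟩ = ⟨a', b⟩ ⟨a, b'⟩`. -/
def tensorPairing : G.Dual ⊗[ℂ] A →ₗ[ℂ] A ⊗[ℂ] G.Dual →ₗ[ℂ] ℂ :=
  TensorProduct.lift <| LinearMap.mk₂ ℂ
    (fun b a => LinearMap.mul' ℂ ℂ ∘ₗ TensorProduct.map (G.toFunctional b) (G.toFunctional.flip a))
    (fun _ _ _ => by ext; simp [add_mul]) (fun _ _ _ => by ext; simp [mul_assoc])
    (fun _ _ _ => by ext; simp [mul_add]) (fun _ _ _ => by ext; simp [mul_left_comm])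

theorem evaluation_tmul (a : A) (b : G.Dual) : G.evaluation (a ⊗ₜ b) = G.pair a b := rfl

theorem tensorPairing_tmul (b b' : G.Dual) (a a' : A) :
    G.tensorPairing (b ⊗ₜ a) (a' ⊗ₜ b') = G.pair a' b * G.pair a b' := rfl

/-- `⟨V, a ⊗ b⟩ = ⟨a, b⟩` for all `a` and `b`, with the pairing extended to
`M(B ⊗ A) × (A ⊗ B)`. -/
def IsDuality (V : MultiplierAlgebra (G.Dual ⊗[ℂ] A)) : Prop :=
  IsExtendedPairing G.tensorPairing V G.evaluation

/-- Formula for `V` as a left multiplier, for `b = φ(c ·)`: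
`V(b ⊗ a) = ∑ φ(c₂ ·) ⊗ S(c₁)a`, where `S(c₁)a ⊗ c₂ = (S ⊗ ι)((S⁻¹(a) ⊗ 1)Δ(c))`.
The equation is read in `A' ⊗ A`, where `A'` is the space of all functionals on `A`. -/
def LeftFormula (V : MultiplierAlgebra (G.Dual ⊗[ℂ] A)) : Prop :=
  ∀ (a c : A) (b : G.Dual), G.toFunctional b = mulLeftFunctional G.φ c →
    G.toFunctional.rTensor A (left V (b ⊗ₜ a))
      = TensorProduct.map (mulLeftFunctional G.φ) G.S.toLinearMap
          (TensorProduct.comm ℂ A A (G.T₂ (G.S.symm a ⊗ₜ c)))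

/-- Formula for `V` as a right multiplier, for `b = ψ(· c)`:
`(b ⊗ a)V = ∑ ψ(· c₁) ⊗ aS(c₂)`, where `c₁ ⊗ aS(c₂) = (ι ⊗ S)(Δ(c)(1 ⊗ S⁻¹(a)))`. -/
def RightFormula (V : MultiplierAlgebra (G.Dual ⊗[ℂ] A)) : Prop :=
  ∀ (a c : A) (b : G.Dual), G.toFunctional b = mulRightFunctional G.ψ c →
    G.toFunctional.rTensor A (right V (b ⊗ₜ a))
      = TensorProduct.map (mulRightFunctional G.ψ) G.S.toLinearMap (G.T₁ (c ⊗ₜ G.S.symm a))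

/-- `W = (ι ⊗ S)V` in `M(B ⊗ A)`. As `S` is an anti-homomorphism of `A`, this means
`W(b ⊗ S(a)) = (ι ⊗ S)((1 ⊗ a)V(b ⊗ 1))` and `(b ⊗ S(a))W = (ι ⊗ S)((b ⊗ 1)V(1 ⊗ a))`, where
`(1 ⊗ a)V(b ⊗ 1)` and `(b ⊗ 1)V(1 ⊗ a)` belong to `B ⊗ A`. -/
def IsAntipodeSnd (V W : MultiplierAlgebra (G.Dual ⊗[ℂ] A)) : Prop :=
  ∀ (a : A) (b : G.Dual),
    (∃ x : G.Dual ⊗[ℂ] A, embed x = inr a * V * inl b ∧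
      left W (b ⊗ₜ G.S a) = G.S.toLinearMap.lTensor G.Dual x) ∧
    (∃ y : G.Dual ⊗[ℂ] A, embed y = inl b * V * inr a ∧
      right W (b ⊗ₜ G.S a) = G.S.toLinearMap.lTensor G.Dual y)

/-- `W = (S ⊗ ι)V` in `M(B ⊗ A)`. As `S` is an anti-homomorphism of `B`, this means
`W(S(b) ⊗ a) = (S ⊗ ι)((b ⊗ 1)V(1 ⊗ a))` and `(S(b) ⊗ a)W = (S ⊗ ι)((1 ⊗ a)V(b ⊗ 1))`, where
`(b ⊗ 1)V(1 ⊗ a)` and `(1 ⊗ a)V(b ⊗ 1)` belong to `B ⊗ A`. -/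
def IsAntipodeFst (V W : MultiplierAlgebra (G.Dual ⊗[ℂ] A)) : Prop :=
  ∀ (a : A) (b : G.Dual),
    (∃ y : G.Dual ⊗[ℂ] A, embed y = inl b * V * inr a ∧
      left W (G.dualS b ⊗ₜ a) = G.dualS.toLinearMap.rTensor A y) ∧
    (∃ x : G.Dual ⊗[ℂ] A, embed x = inr a * V * inl b ∧
      right W (G.dualS b ⊗ₜ a) = G.dualS.toLinearMap.rTensor A x)

end AlgebraicQuantumGroup

end

/-! An element x of B ⊗ A is regarded as the map A → A, a' ↦ (⟨a', ·⟩ ⊗ ι)x (`evalFst`), which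
determines it (`eq_of_evalFst`). In this picture V is the identity map of A. Write b ▷ a' = (ι ⊗
b)Δ(a') and a' ◁ b = (b ⊗ ι)Δ(a'). The condition ⟨V, a ⊗ b⟩ = ⟨a, b⟩ says that V(b ⊗ a) is the map
a' ↦ (b ▷ a')a and that (b ⊗ a)V is a' ↦ a(a' ◁ b). Uniqueness is then clear, and existence means
realising these two maps by tensors.

The tool for this is the formula S(c₁)φ(c₂a') = a'₁φ(ca'₂) (`S_sliceRight_T₁`). For b = φ(c ·) its
right side is b ▷ a', so φ(c₂ ·) ⊗ S(c₁)a has the required slices. The analogous formula for ψ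
(`S_sliceLeft_T₂`) gives (b ⊗ a)V. With the factor a on the other side, the same computation puts (1
⊗ a)V(b ⊗ 1) and (b ⊗ 1)V(1 ⊗ a) in B ⊗ A.

The formula also produces the antipode: the surjections a ⊗ b ↦ a₁φ(a₂b) and a ⊗ b ↦ b₁φ(ab₂) have
the same kernel, hence differ by a linear bijection S of A. It follows that S reverses products and
coproducts, that ψ is right invariant, that φ is faithful, and that φ(· c), φ(c ·), ψ(· c) and ψ(c
·) all sweep out B.

Finally (ι ⊗ S)V and (S ⊗ ι)V both correspond to the map S of A, because the antipode of B is the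
transpose of that of A. A single multiplier serves for both (`exists_antipode_duality`). -/

noncomputable section

/-! ### Slice maps and separation of points. -/

section Slice

variable {V V' W W' : Type*} [AddCommGroup V] [Module ℂ V] [AddCommGroup W] [Module ℂ W]
  [AddCommGroup V'] [Module ℂ V'] [AddCommGroup W'] [Module ℂ W']

theorem sliceRight_rTensor (f : V →ₗ[ℂ] V') (ω : W →ₗ[ℂ] ℂ) (z : V ⊗[ℂ] W) :
    sliceRight ω (f.rTensor W z) = f (sliceRight ω z) := by
  induction z with
  | zero => simp
  | add x y hx hy => simp_all
  | tmul v w => simp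

theorem sliceRight_lTensor (f : W →ₗ[ℂ] W') (ω : W' →ₗ[ℂ] ℂ) (z : V ⊗[ℂ] W) :
    sliceRight ω (f.lTensor V z) = sliceRight (ω ∘ₗ f) z := by
  induction z with
  | zero => simp
  | add x y hx hy => simp_all
  | tmul v w => simp

theorem sliceLeft_lTensor (f : W →ₗ[ℂ] W') (ω : V →ₗ[ℂ] ℂ) (z : V ⊗[ℂ] W) :
    sliceLeft ω (f.lTensor V z) = f (sliceLeft ω z) := by
  induction z with
  | zero => simp
  | add x y hx hy => simp_all
  | tmul v w => simp

theorem sliceLeft_rTensor (f : V →ₗ[ℂ] V') (ω : V' →ₗ[ℂ] ℂ) (z : V ⊗[ℂ] W) :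
    sliceLeft ω (f.rTensor W z) = sliceLeft (ω ∘ₗ f) z := by
  induction z with
  | zero => simp
  | add x y hx hy => simp_all
  | tmul v w => simp

theorem sliceLeft_comm (ω : W →ₗ[ℂ] ℂ) (z : V ⊗[ℂ] W) :
    sliceLeft ω (TensorProduct.comm ℂ V W z) = sliceRight ω z := by
  induction z with
  | zero => simp
  | add x y hx hy => simp_all
  | tmul v w => simp

theorem apply_sliceRight (ω : V →ₗ[ℂ] ℂ) (θ : W →ₗ[ℂ] ℂ) (z : V ⊗[ℂ] W) :
    ω (sliceRight θ z) = θ (sliceLeft ω z) := by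
  induction z with
  | zero => simp
  | add x y hx hy => simp_all
  | tmul v w => simp [mul_comm]

theorem comm_lTensor (f : W →ₗ[ℂ] W') (z : V ⊗[ℂ] W) :
    TensorProduct.comm ℂ V W' (f.lTensor V z) = f.rTensor V (TensorProduct.comm ℂ V W z) := by
  induction z with
  | zero => simp
  | add x y hx hy => simp_all
  | tmul v w => simp

theorem rTensor_lTensor_apply (f : V →ₗ[ℂ] V') (g : W →ₗ[ℂ] W') (z : V ⊗[ℂ] W) :
    f.rTensor W' (g.lTensor V z) = g.lTensor V' (f.rTensor W z) := by
  induction z with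
  | zero => simp
  | add x y hx hy => simp_all
  | tmul v w => simp

theorem sliceRight_surjective {ω : W →ₗ[ℂ] ℂ} (h : ω ≠ 0) :
    Function.Surjective (sliceRight ω : V ⊗[ℂ] W → V) := by
  obtain ⟨w, hw⟩ : ∃ w, ω w ≠ 0 := by
    by_contra! h'
    exact h (LinearMap.ext h')
  exact fun v => ⟨v ⊗ₜ ((ω w)⁻¹ • w), by simp [hw]⟩

theorem sliceLeft_surjective {ω : V →ₗ[ℂ] ℂ} (h : ω ≠ 0) :
    Function.Surjective (sliceLeft ω : V ⊗[ℂ] W → W) := by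
  obtain ⟨w, hw⟩ : ∃ w, ω w ≠ 0 := by
    by_contra! h'
    exact h (LinearMap.ext h')
  exact fun v => ⟨((ω w)⁻¹ • w) ⊗ₜ v, by simp [hw]⟩

/-- If the maps `F i` jointly separate points, so do the maps `F i ⊗ ι`. -/
theorem eq_of_rTensor {ι : Type*} (F : ι → V →ₗ[ℂ] V') (hF : ∀ v, (∀ i, F i v = 0) → v = 0)
    {z z' : V ⊗[ℂ] W} (h : ∀ i, (F i).rTensor W z = (F i).rTensor W z') : z = z' := by
  rw [← sub_eq_zero]
  refine eq_zero_of_sliceRight _ fun ω => hF _ fun i => ?_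
  rw [← sliceRight_rTensor, map_sub, h, sub_self, map_zero]

/-- If the maps `F i` jointly separate points, so do the maps `ι ⊗ F i`. -/
theorem eq_of_lTensor {ι : Type*} (F : ι → W →ₗ[ℂ] W') (hF : ∀ v, (∀ i, F i v = 0) → v = 0)
    {z z' : V ⊗[ℂ] W} (h : ∀ i, (F i).lTensor V z = (F i).lTensor V z') : z = z' := by
  rw [← sub_eq_zero]
  refine eq_zero_of_sliceLeft _ fun ω => hF _ fun i => ?_
  rw [← sliceLeft_lTensor, map_sub, h, sub_self, map_zero]

end Slice

/-! ### Coassociativity and slices -/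

section Coassociative

variable {A : Type*} [AddCommGroup A] [Module ℂ A]

/-- The map `b ⊗ c ↦ (T' ⊗ ι)(a ⊗ b ⊗ c)`. -/
def firstLegs (T' : A ⊗[ℂ] A →ₗ[ℂ] A ⊗[ℂ] A) (a : A) : A ⊗[ℂ] A →ₗ[ℂ] A ⊗[ℂ] (A ⊗[ℂ] A) :=
  (TensorProduct.assoc ℂ A A A).toLinearMap ∘ₗ T'.rTensor A ∘ₗ
    (TensorProduct.assoc ℂ A A A).symm.toLinearMap ∘ₗ TensorProduct.mk ℂ A (A ⊗[ℂ] A) a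

theorem firstLegs_tmul (T' : A ⊗[ℂ] A →ₗ[ℂ] A ⊗[ℂ] A) (a b c : A) :
    firstLegs T' a (b ⊗ₜ c) = TensorProduct.assoc ℂ A A A (T' (a ⊗ₜ b) ⊗ₜ c) := by
  simp [firstLegs]

theorem lTensor_assoc_tmul {V : Type*} [AddCommGroup V] [Module ℂ V]
    (f : A ⊗[ℂ] A →ₗ[ℂ] V) (w : A ⊗[ℂ] A) (c : A) :
    f.lTensor A (TensorProduct.assoc ℂ A A A (w ⊗ₜ c))
      = (f ∘ₗ (TensorProduct.mk ℂ A A).flip c).lTensor A w := by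
  induction w with
  | zero => simp
  | add x y hx hy => simp_all [TensorProduct.add_tmul]
  | tmul v w => simp

/-- Coassociativity as commutation of T' on legs 1, 2 with T on legs 2, 3. In this form functionals,
or the inverse of T, can be applied to the legs. -/
theorem Coassociative.firstLegs_apply {T T' : A ⊗[ℂ] A →ₗ[ℂ] A ⊗[ℂ] A}
    (h : Coassociative T T') (a : A) (y : A ⊗[ℂ] A) :
    firstLegs T' a (T y) = T.lTensor A (firstLegs T' a y) := by
  induction y with
  | zero => simp
  | add x y hx hy => simp_all
  | tmul b c => rw [firstLegs_tmul, ← h a b c]; rfl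

theorem sliceRight_lTensor_firstLegs (T' : A ⊗[ℂ] A →ₗ[ℂ] A ⊗[ℂ] A) (f : A →ₗ[ℂ] ℂ) (a : A)
    (y : A ⊗[ℂ] A) :
    (sliceRight f).lTensor A (firstLegs T' a y) = T' (a ⊗ₜ sliceRight f y) := by
  induction y with
  | zero => simp
  | add x y hx hy => simp_all [TensorProduct.tmul_add]
  | tmul b c =>
    rw [firstLegs_tmul, lTensor_assoc_tmul]
    have : T' (a ⊗ₜ sliceRight f (b ⊗ₜ[ℂ] c)) = f c • T' (a ⊗ₜ b) := by simp
    rw [this]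
    generalize T' (a ⊗ₜ b) = w
    induction w with
    | zero => simp
    | add x y hx hy => simp_all
    | tmul v w => simp

/-- The slice `b ↦ (ι ⊗ f)(T (b ⊗ c))` commutes with `T'`. -/
theorem Coassociative.apply_tmul_sliceRight {T T' : A ⊗[ℂ] A →ₗ[ℂ] A ⊗[ℂ] A}
    (h : Coassociative T T') (f : A →ₗ[ℂ] ℂ) (a b c : A) :
    T' (a ⊗ₜ sliceRight f (T (b ⊗ₜ c)))
      = (sliceRight f ∘ₗ T ∘ₗ (TensorProduct.mk ℂ A A).flip c).lTensor A (T' (a ⊗ₜ b)) := by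
  rw [← sliceRight_lTensor_firstLegs, h.firstLegs_apply, firstLegs_tmul,
    ← LinearMap.comp_apply, ← LinearMap.lTensor_comp, lTensor_assoc_tmul, LinearMap.comp_assoc]

theorem sliceLeft_firstLegs (T' : A ⊗[ℂ] A →ₗ[ℂ] A ⊗[ℂ] A) (f : A →ₗ[ℂ] ℂ) (a : A)
    (y : A ⊗[ℂ] A) :
    sliceLeft f (firstLegs T' a y)
      = (sliceLeft f ∘ₗ T' ∘ₗ TensorProduct.mk ℂ A A a).rTensor A y := by
  induction y with
  | zero => simp
  | add x y hx hy => simp_all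
  | tmul b c =>
    rw [firstLegs_tmul, LinearMap.rTensor_tmul]
    simp only [LinearMap.comp_apply, TensorProduct.mk_apply]
    generalize T' (a ⊗ₜ b) = w
    induction w with
    | zero => simp
    | add x y hx hy => simp_all [TensorProduct.add_tmul]
    | tmul v w => simp [TensorProduct.smul_tmul']

/-- The slice `b ↦ (f ⊗ ι)(T' (a ⊗ b))` commutes with `T`. -/
theorem Coassociative.apply_sliceLeft_tmul {T T' : A ⊗[ℂ] A →ₗ[ℂ] A ⊗[ℂ] A}
    (h : Coassociative T T') (f : A →ₗ[ℂ] ℂ) (a b c : A) :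
    T (sliceLeft f (T' (a ⊗ₜ b)) ⊗ₜ c)
      = (sliceLeft f ∘ₗ T' ∘ₗ TensorProduct.mk ℂ A A a).rTensor A (T (b ⊗ₜ c)) := by
  rw [← sliceLeft_firstLegs, h.firstLegs_apply, sliceLeft_lTensor, sliceLeft_firstLegs]
  rfl

end Coassociative

open MultiplierAlgebra

namespace RegularMultiplierHopfAlgebra

variable {A : Type*} [NonUnitalRing A] [Module ℂ A] [IsScalarTower ℂ A A] [SMulCommClass ℂ A A]
variable (H : RegularMultiplierHopfAlgebra A)

theorem eq_of_mulLeft_rTensor (H : RegularMultiplierHopfAlgebra A) {z z' : A ⊗[ℂ] A} (h : ∀ t, (LinearMap.mulLeft ℂ t).rTensor A z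
    = (LinearMap.mulLeft ℂ t).rTensor A z') : z = z' :=
  eq_of_rTensor _ (fun v hv => H.nondegenerate.2 v hv) h

theorem eq_of_mulRight_rTensor (H : RegularMultiplierHopfAlgebra A) {z z' : A ⊗[ℂ] A} (h : ∀ t, (LinearMap.mulRight ℂ t).rTensor A z
    = (LinearMap.mulRight ℂ t).rTensor A z') : z = z' :=
  eq_of_rTensor _ (fun v hv => H.nondegenerate.1 v hv) h

theorem eq_of_mulRight_lTensor (H : RegularMultiplierHopfAlgebra A) {z z' : A ⊗[ℂ] A} (h : ∀ t, (LinearMap.mulRight ℂ t).lTensor A z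
    = (LinearMap.mulRight ℂ t).lTensor A z') : z = z' :=
  eq_of_lTensor _ (fun v hv => H.nondegenerate.1 v hv) h

theorem eq_of_mul_left (H : RegularMultiplierHopfAlgebra A) {x y : A} (h : ∀ z, z * x = z * y) : x = y := by
  rw [← sub_eq_zero]
  exact H.nondegenerate.2 _ fun z => by rw [mul_sub, h, sub_self]

theorem eq_of_mul_right (H : RegularMultiplierHopfAlgebra A) {x y : A} (h : ∀ z, x * z = y * z) : x = y := by
  rw [← sub_eq_zero]
  exact H.nondegenerate.1 _ fun z => by rw [sub_mul, h, sub_self]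

theorem embed_tensor_injective (H : RegularMultiplierHopfAlgebra A) : Function.Injective
    (embed : A ⊗[ℂ] A → MultiplierAlgebra (A ⊗[ℂ] A)) :=
  embed_injective (H.nondegenerate.tensor H.nondegenerate)

theorem inl_mul_inr (c d : A) : (inl c * inr d : MultiplierAlgebra (A ⊗[ℂ] A))
    = inr d * inl c := by
  ext y <;> induction y with
  | zero => simp
  | add y y' hy hy' => simp_all [mul_add, add_mul]
  | tmul r s =>
    simp [left_mul_apply, right_mul_apply, left_inl, left_inr, right_inl, right_inr]

/-! ### Compatibility of the canonical maps -/

/-- Associativity in M(A ⊗ A). This relation and the following ones pass from one canonical map to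
another by covering a further leg with an arbitrary element, which non-degeneracy later removes. -/
theorem mulLeft_rTensor_T₁ (t a b : A) : (LinearMap.mulLeft ℂ t).rTensor A (H.T₁ (a ⊗ₜ b))
    = (LinearMap.mulRight ℂ b).lTensor A (H.T₂ (t ⊗ₜ a)) := by
  apply H.embed_tensor_injective
  rw [← left_inl, ← right_inr, ← mul_embed, ← embed_mul, H.embed_T₁, H.embed_T₂, mul_assoc]

theorem mulRight_rTensor_T₁ (t a b : A) : (LinearMap.mulRight ℂ t).rTensor A (H.T₁ (a ⊗ₜ b))
    = (LinearMap.mulRight ℂ b).lTensor A (H.T₃ (a ⊗ₜ t)) := by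
  apply H.embed_tensor_injective
  rw [← right_inl, ← right_inr, ← embed_mul, ← embed_mul, H.embed_T₁, H.embed_T₃, mul_assoc,
    mul_assoc, inl_mul_inr]

theorem mulLeft_lTensor_T₁ (t a b : A) : (LinearMap.mulLeft ℂ t).lTensor A (H.T₁ (a ⊗ₜ b))
    = (LinearMap.mulRight ℂ b).lTensor A (H.T₄ (t ⊗ₜ a)) := by
  apply H.embed_tensor_injective
  rw [← left_inr, ← right_inr, ← mul_embed, ← embed_mul, H.embed_T₁, H.embed_T₄, mul_assoc]

theorem mulLeft_rTensor_T₃ (t a b : A) : (LinearMap.mulLeft ℂ t).rTensor A (H.T₃ (a ⊗ₜ b))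
    = (LinearMap.mulRight ℂ b).rTensor A (H.T₂ (t ⊗ₜ a)) := by
  apply H.embed_tensor_injective
  rw [← left_inl, ← right_inl, ← mul_embed, ← embed_mul, H.embed_T₃, H.embed_T₂, mul_assoc]

theorem mulLeft_lTensor_T₃ (t a b : A) : (LinearMap.mulLeft ℂ t).lTensor A (H.T₃ (a ⊗ₜ b))
    = (LinearMap.mulRight ℂ b).rTensor A (H.T₄ (t ⊗ₜ a)) := by
  apply H.embed_tensor_injective
  rw [← left_inr, ← right_inl, ← mul_embed, ← embed_mul, H.embed_T₃, H.embed_T₄, mul_assoc]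

theorem mulLeft_lTensor_T₂ (t s a : A) : (LinearMap.mulLeft ℂ t).lTensor A (H.T₂ (s ⊗ₜ a))
    = (LinearMap.mulLeft ℂ s).rTensor A (H.T₄ (t ⊗ₜ a)) := by
  apply H.embed_tensor_injective
  rw [← left_inr, ← left_inl, ← mul_embed, ← mul_embed, H.embed_T₂, H.embed_T₄, ← mul_assoc,
    ← mul_assoc, inl_mul_inr]

theorem left_comul_tmul (a c d : A) : left (H.comul a) (c ⊗ₜ d)
    = (LinearMap.mulRight ℂ c).rTensor A (H.T₁ (a ⊗ₜ d)) := by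
  apply H.embed_tensor_injective
  rw [← right_inl, ← embed_mul, ← mul_embed, H.embed_T₁, mul_assoc, inr_mul_inl]

theorem right_comul_tmul (a c d : A) : right (H.comul a) (c ⊗ₜ d)
    = (LinearMap.mulLeft ℂ d).lTensor A (H.T₂ (c ⊗ₜ a)) := by
  apply H.embed_tensor_injective
  rw [← left_inr, ← embed_mul, ← mul_embed, H.embed_T₂, ← mul_assoc, inr_mul_inl]

/-- Δ(a)Δ(p)(1 ⊗ q) = Δ(ap)(1 ⊗ q). The two variants below rest on multiplicativity of Δ in the same
way. -/
theorem left_comul_T₁ (a : A) (z : A ⊗[ℂ] A) :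
    left (H.comul a) (H.T₁ z) = H.T₁ ((LinearMap.mulLeft ℂ a).rTensor A z) := by
  induction z with
  | zero => simp
  | add x y hx hy => simp_all
  | tmul v w =>
    apply H.embed_tensor_injective
    rw [← mul_embed, LinearMap.rTensor_tmul, H.embed_T₁, H.embed_T₁, LinearMap.mulLeft_apply,
      map_mul, mul_assoc]

theorem left_comul_T₃ (a : A) (z : A ⊗[ℂ] A) :
    left (H.comul a) (H.T₃ z) = H.T₃ ((LinearMap.mulLeft ℂ a).rTensor A z) := by
  induction z with
  | zero => simp
  | add x y hx hy => simp_all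
  | tmul v w =>
    apply H.embed_tensor_injective
    rw [← mul_embed, LinearMap.rTensor_tmul, H.embed_T₃, H.embed_T₃, LinearMap.mulLeft_apply,
      map_mul, mul_assoc]

theorem right_comul_T₂ (a : A) (z : A ⊗[ℂ] A) :
    right (H.comul a) (H.T₂ z) = H.T₂ ((LinearMap.mulRight ℂ a).lTensor A z) := by
  induction z with
  | zero => simp
  | add x y hx hy => simp_all
  | tmul v w =>
    apply H.embed_tensor_injective
    rw [← embed_mul, LinearMap.lTensor_tmul, H.embed_T₂, H.embed_T₂, LinearMap.mulRight_apply,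
      map_mul, mul_assoc]

/-- `a ↦ a₁ f(a₂ s)` -/
def sliceT₁ (f : A →ₗ[ℂ] ℂ) (s : A) : A →ₗ[ℂ] A :=
  sliceRight f ∘ₗ H.T₁.toLinearMap ∘ₗ (TensorProduct.mk ℂ A A).flip s

/-- `a ↦ a₁ f(s a₂)` -/
def sliceT₄ (f : A →ₗ[ℂ] ℂ) (s : A) : A →ₗ[ℂ] A :=
  sliceRight f ∘ₗ H.T₄.toLinearMap ∘ₗ TensorProduct.mk ℂ A A s

@[simp] theorem sliceT₁_apply (f : A →ₗ[ℂ] ℂ) (s a : A) :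
    H.sliceT₁ f s a = sliceRight f (H.T₁ (a ⊗ₜ s)) := rfl

@[simp] theorem sliceT₄_apply (f : A →ₗ[ℂ] ℂ) (s a : A) :
    H.sliceT₄ f s a = sliceRight f (H.T₄ (s ⊗ₜ a)) := rfl

theorem T₂_sliceT₁ (f : A →ₗ[ℂ] ℂ) (t s a : A) :
    H.T₂ (t ⊗ₜ H.sliceT₁ f s a) = (H.sliceT₁ f s).lTensor A (H.T₂ (t ⊗ₜ a)) :=
  H.coassoc.apply_tmul_sliceRight f t a s

theorem T₃_sliceT₄ (f : A →ₗ[ℂ] ℂ) (s a t : A) :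
    H.T₃ (H.sliceT₄ f s a ⊗ₜ t) = (H.sliceT₄ f s).lTensor A (H.T₃ (a ⊗ₜ t)) := by
  have h := H.coassoc_cop.apply_sliceLeft_tmul f s a t
  simp only [LinearMap.comp_apply, LinearEquiv.coe_coe, sliceLeft_comm] at h
  apply (TensorProduct.comm ℂ A A).injective
  rw [sliceT₄_apply, h, comm_lTensor]
  congr 2
  ext b
  simp [sliceLeft_comm]

/-- Coassociativity of the flipped coproduct gives this for `T₃`; multiplying the first leg from the
right by r and from the left by t turns `T₃` into `T₂`. -/
theorem T₂_sliceT₄ (f : A →ₗ[ℂ] ℂ) (t s a : A) :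
    H.T₂ (t ⊗ₜ H.sliceT₄ f s a) = (H.sliceT₄ f s).lTensor A (H.T₂ (t ⊗ₜ a)) := by
  refine H.eq_of_mulRight_rTensor fun r => ?_
  rw [← mulLeft_rTensor_T₃, T₃_sliceT₄, rTensor_lTensor_apply, rTensor_lTensor_apply,
    mulLeft_rTensor_T₃]

/-! ### The counit -/

/-- Source of the counit: comparing the two sides shows that the product of the legs of T₁⁻¹(q ⊗ c)
is a scalar multiple of c. With p ⊗ q = T₂(a ⊗ b), the inverse of `T₁` on legs 2, 3 commutes with
`T₂` on legs 1, 2; multiplying legs 2 and 3 then gives (a ⊗ 1)T₁T₁⁻¹(b ⊗ c) = ab ⊗ c. -/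
theorem lTensor_mul'_T₁_symm (p q c : A) :
    p ⊗ₜ[ℂ] LinearMap.mul' ℂ A (H.T₁.symm (q ⊗ₜ c))
      = LinearMap.mul' ℂ A (H.T₂.symm (p ⊗ₜ q)) ⊗ₜ[ℂ] c := by
  have key : ∀ v : A ⊗[ℂ] A,
      (LinearMap.mul' ℂ A ∘ₗ H.T₁.symm.toLinearMap ∘ₗ
        (TensorProduct.mk ℂ A A).flip c).lTensor A (H.T₂ v) = LinearMap.mul' ℂ A v ⊗ₜ[ℂ] c := by
    intro v
    induction v with
    | zero => simp
    | add x y hx hy => simp_all [TensorProduct.add_tmul]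
    | tmul a b =>
      have h := H.coassoc.firstLegs_apply a (H.T₁.symm (b ⊗ₜ c))
      apply_fun (LinearMap.mul' ℂ A ∘ₗ H.T₁.symm.toLinearMap).lTensor A at h
      simp only [LinearEquiv.coe_coe, LinearEquiv.apply_symm_apply] at h
      rw [firstLegs_tmul, lTensor_assoc_tmul, LinearMap.comp_assoc,
        ← LinearMap.lTensor_comp_apply, LinearMap.comp_assoc, LinearEquiv.symm_comp,
        LinearMap.comp_id] at h
      refine h.trans ?_
      have h2 : ∀ y : A ⊗[ℂ] A, (LinearMap.mul' ℂ A).lTensor A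
          (firstLegs H.T₂.toLinearMap a y) = (LinearMap.mulLeft ℂ a).rTensor A (H.T₁ y) := by
        intro y
        induction y with
        | zero => simp
        | add x y hx hy => simp_all
        | tmul p q =>
          rw [firstLegs_tmul, lTensor_assoc_tmul, mulLeft_rTensor_T₁]
          congr 1
      rw [h2]
      simp
  have h := key (H.T₂.symm (p ⊗ₜ q))
  simpa using h

theorem exists_counit [Nontrivial A] : ∃ ε, H.IsCounit ε := by
  obtain ⟨p, hp⟩ := exists_ne (0 : A)
  obtain ⟨ω, hω⟩ := Module.Projective.exists_dual_eq_one ℂ hp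
  let ε : A →ₗ[ℂ] ℂ := ω ∘ₗ LinearMap.mul' ℂ A ∘ₗ H.T₂.symm.toLinearMap ∘ₗ
    TensorProduct.mk ℂ A A p
  -- Slicing the first leg by ω, where ω(p) = 1, isolates the scalar ε(q).
  have h1 : ∀ q c, LinearMap.mul' ℂ A (H.T₁.symm (q ⊗ₜ c)) = ε q • c := fun q c => by
    have h := congrArg (sliceLeft ω) (H.lTensor_mul'_T₁_symm p q c)
    simpa [hω, ε] using h
  have h2 : ∀ r q, LinearMap.mul' ℂ A (H.T₂.symm (r ⊗ₜ q)) = ε q • r := fun r q => by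
    have h := congrArg (sliceRight ω) (H.lTensor_mul'_T₁_symm r q p)
    rw [h1] at h
    simpa [hω] using h.symm
  have h3 : ∀ z, sliceLeft ε z = LinearMap.mul' ℂ A (H.T₁.symm z) := fun z => by
    induction z with
    | zero => simp
    | add x y hx hy => simp_all
    | tmul v w => simp [h1]
  have h4 : ∀ z, sliceRight ε z = LinearMap.mul' ℂ A (H.T₂.symm z) := fun z => by
    induction z with
    | zero => simp
    | add x y hx hy => simp_all
    | tmul v w => simp [h2]
  exact ⟨ε, fun a b => by simp [h3], fun a b => by simp [h4]⟩

namespace IsCounit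

variable {H} {ε : A →ₗ[ℂ] ℂ} (hε : H.IsCounit ε)
include hε

theorem sliceLeft_T₁ (z : A ⊗[ℂ] A) : sliceLeft ε (H.T₁ z) = LinearMap.mul' ℂ A z := by
  induction z with
  | zero => simp
  | add x y hx hy => simp_all
  | tmul v w => simp [hε.1]

theorem sliceLeft_T₄ (s a : A) : sliceLeft ε (H.T₄ (s ⊗ₜ a)) = s * a := by
  refine H.eq_of_mul_right fun t => ?_
  have h := congrArg (sliceLeft ε) (H.mulLeft_lTensor_T₁ s a t)
  rw [sliceLeft_lTensor, sliceLeft_lTensor, hε.1] at h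
  simpa [mul_assoc] using h.symm

theorem sliceRight_T₃ (a b : A) : sliceRight ε (H.T₃ (a ⊗ₜ b)) = a * b := by
  refine H.eq_of_mul_left fun t => ?_
  have h := congrArg (sliceRight ε) (H.mulLeft_rTensor_T₃ t a b)
  rw [sliceRight_rTensor, sliceRight_rTensor, hε.2] at h
  simpa [mul_assoc] using h

theorem unique [Nontrivial A] {ε' : A →ₗ[ℂ] ℂ} (hε' : H.IsCounit ε') : ε = ε' := by
  obtain ⟨p, hp⟩ := exists_ne (0 : A)
  ext a
  have h : sliceLeft ε (H.T₁ (H.T₁.symm (a ⊗ₜ p))) = sliceLeft ε' (H.T₁ (H.T₁.symm (a ⊗ₜ p))) := by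
    rw [hε.sliceLeft_T₁, hε'.sliceLeft_T₁]
  simp only [LinearEquiv.apply_symm_apply, sliceLeft_tmul] at h
  exact smul_left_injective ℂ hp h

theorem ne_zero [Nontrivial A] : ε ≠ 0 := by
  rintro rfl
  have h : ∀ a b : A, a * b = 0 := fun a b => by rw [← hε.1]; simp [sliceLeft]
  obtain ⟨p, hp⟩ := exists_ne (0 : A)
  exact hp (H.nondegenerate.1 p (h p))

theorem mul'_surjective [Nontrivial A] : Function.Surjective (LinearMap.mul' ℂ A) := fun a => by
  obtain ⟨z, hz⟩ := sliceLeft_surjective (W := A) hε.ne_zero a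
  exact ⟨H.T₁.symm z, by rw [← hε.sliceLeft_T₁, LinearEquiv.apply_symm_apply, hz]⟩

theorem sliceLeft_comul (a : A) (z : A ⊗[ℂ] A) :
    sliceLeft ε (left (H.comul a) z) = a * sliceLeft ε z := by
  obtain ⟨w, rfl⟩ := H.T₁.surjective z
  rw [left_comul_T₁, hε.sliceLeft_T₁, hε.sliceLeft_T₁]
  induction w with
  | zero => simp
  | add x y hx hy => simp_all [mul_add]
  | tmul v w => simp [mul_assoc]

/-- Since ε ⊗ ι turns Δ(a) into a, the slices of Δ(a)(1 ⊗ q) by ε(· p) and by ε(p)ε are both ε(p)aq.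
As `T₁` is onto, the two functionals agree. -/
theorem map_mul [Nontrivial A] (x p : A) : ε (x * p) = ε x * ε p := by
  obtain ⟨y, hy⟩ := exists_ne (0 : A)
  have h : ∀ w : A ⊗[ℂ] A, sliceLeft (ε ∘ₗ LinearMap.mulRight ℂ p) (H.T₁ w)
      = ε p • sliceLeft ε (H.T₁ w) := fun w => by
    induction w with
    | zero => simp
    | add x y hx hy => simp_all
    | tmul a q =>
      rw [← sliceLeft_rTensor, ← left_comul_tmul, hε.sliceLeft_comul, hε.1]
      simp [mul_smul_comm]
  have h' := h (H.T₁.symm (x ⊗ₜ y))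
  simp only [LinearEquiv.apply_symm_apply, sliceLeft_tmul, smul_smul] at h'
  rw [mul_comm (ε x)]
  exact smul_left_injective ℂ hy h'

end IsCounit

end RegularMultiplierHopfAlgebra

/-! ### Left integrals and the construction of the antipode. -/

theorem lTensor_smulRight_apply {V W A : Type*} [AddCommGroup V] [Module ℂ V] [AddCommGroup W]
    [Module ℂ W] [AddCommGroup A] [Module ℂ A] (f : W →ₗ[ℂ] ℂ) (q : A) (z : V ⊗[ℂ] W) :
    (f.smulRight q).lTensor V z = sliceRight f z ⊗ₜ[ℂ] q := by
  induction z with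
  | zero => simp
  | add x y hx hy => simp_all [TensorProduct.add_tmul]
  | tmul v w => simp [TensorProduct.smul_tmul]

/-- Surjective linear maps with the same kernel differ by an isomorphism of their targets. -/
theorem exists_linearEquiv_of_ker_eq {X A : Type*} [AddCommGroup X] [Module ℂ X]
    [AddCommGroup A] [Module ℂ A] {f g : X →ₗ[ℂ] A} (hf : Function.Surjective f)
    (hg : Function.Surjective g) (h : ∀ x, f x = 0 ↔ g x = 0) :
    ∃ S : A ≃ₗ[ℂ] A, ∀ x, S (f x) = g x := by
  have hk : LinearMap.ker f = LinearMap.ker g := by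
    ext x
    simp [h]
  refine ⟨(f.quotKerEquivOfSurjective hf).symm ≪≫ₗ Submodule.quotEquivOfEq _ _ hk ≪≫ₗ
    g.quotKerEquivOfSurjective hg, fun x => ?_⟩
  have : (f.quotKerEquivOfSurjective hf).symm (f x) = Submodule.Quotient.mk x := by
    rw [LinearEquiv.symm_apply_eq]
    rfl
  rw [LinearEquiv.trans_apply, LinearEquiv.trans_apply, this]
  rfl

namespace RegularMultiplierHopfAlgebra

variable {A : Type*} [NonUnitalRing A] [Module ℂ A] [IsScalarTower ℂ A A] [SMulCommClass ℂ A A]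
variable (H : RegularMultiplierHopfAlgebra A)

/-- `a ↦ Δ(a) z` -/
def comulLeft (z : A ⊗[ℂ] A) : A →ₗ[ℂ] A ⊗[ℂ] A where
  toFun a := left (H.comul a) z
  map_add' a b := by rw [map_add]; rfl
  map_smul' r a := by rw [map_smul]; rfl

/-- `a ↦ z Δ(a)` -/
def comulRight (z : A ⊗[ℂ] A) : A →ₗ[ℂ] A ⊗[ℂ] A where
  toFun a := right (H.comul a) z
  map_add' a b := by rw [map_add]; rfl
  map_smul' r a := by rw [map_smul]; rfl

theorem comulLeft_apply (z : A ⊗[ℂ] A) (a : A) : H.comulLeft z a = left (H.comul a) z := rfl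

theorem comulRight_apply (z : A ⊗[ℂ] A) (a : A) : H.comulRight z a = right (H.comul a) z := rfl

theorem comulLeft_add (z z' : A ⊗[ℂ] A) :
    H.comulLeft (z + z') = H.comulLeft z + H.comulLeft z' :=
  LinearMap.ext fun a => map_add (left (H.comul a)) z z'

theorem comulRight_add (z z' : A ⊗[ℂ] A) :
    H.comulRight (z + z') = H.comulRight z + H.comulRight z' :=
  LinearMap.ext fun a => map_add (right (H.comul a)) z z'

theorem comulLeft_zero : H.comulLeft 0 = 0 := LinearMap.ext fun a => map_zero (left (H.comul a))

theorem comulRight_zero : H.comulRight 0 = 0 :=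
  LinearMap.ext fun a => map_zero (right (H.comul a))

theorem sliceRight_comulLeft_tmul (f : A →ₗ[ℂ] ℂ) (r s : A) :
    sliceRight f ∘ₗ H.comulLeft (r ⊗ₜ s) = LinearMap.mulRight ℂ r ∘ₗ H.sliceT₁ f s := by
  ext a
  simp [comulLeft_apply, left_comul_tmul, sliceRight_rTensor]

theorem sliceRight_comulRight_tmul (f : A →ₗ[ℂ] ℂ) (r s : A) :
    sliceRight f ∘ₗ H.comulRight (r ⊗ₜ s) = LinearMap.mulLeft ℂ r ∘ₗ H.sliceT₄ f s := by
  ext a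
  simp [comulRight_apply, right_comul_tmul, mulLeft_lTensor_T₂, sliceRight_rTensor]

namespace IsLeftIntegral

variable {H} {φ : A →ₗ[ℂ] ℂ} (hφ : H.IsLeftIntegral φ)
include hφ

/-- `(a₁ ⊗ a₂ b₁ q) φ(a₃ b₂) = a₁ φ(a₂ b) ⊗ q` -/
theorem T₁_slice (a b q : A) :
    H.T₁ (TensorProduct.comm ℂ A A ((sliceRight φ ∘ₗ H.T₁.toLinearMap ∘ₗ
      TensorProduct.mk ℂ A A a).lTensor A (H.T₃ (b ⊗ₜ q))))
      = sliceRight φ (H.T₁ (a ⊗ₜ b)) ⊗ₜ[ℂ] q := by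
  refine H.eq_of_mulLeft_rTensor fun t => ?_
  -- Replacing Δ(b)(q ⊗ 1) by an arbitrary z makes both sides linear in z, so simple tensors
  -- suffice; the right side is ta₁ ⊗ (ι ⊗ φ)(Δ(a₂)z).
  have key : ∀ z : A ⊗[ℂ] A, (LinearMap.mulLeft ℂ t).rTensor A
      (H.T₁ (TensorProduct.comm ℂ A A ((sliceRight φ ∘ₗ H.T₁.toLinearMap ∘ₗ
        TensorProduct.mk ℂ A A a).lTensor A z)))
      = (sliceRight φ ∘ₗ H.comulLeft z).lTensor A (H.T₂ (t ⊗ₜ a)) := by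
    intro z
    induction z with
    | zero => simp [comulLeft_zero]
    | add x y hx hy => simp_all [comulLeft_add, LinearMap.comp_add, LinearMap.lTensor_add]
    | tmul r s =>
      rw [sliceRight_comulLeft_tmul, LinearMap.lTensor_comp_apply A (LinearMap.mulRight ℂ r), ← T₂_sliceT₁,
        ← mulLeft_rTensor_T₁]
      rfl
  -- For z = Δ(b)(q ⊗ 1) one has Δ(a')z = Δ(a'b)(q ⊗ 1), and left invariance collapses its slice to
  -- φ(a'b)q.
  have h : sliceRight φ ∘ₗ H.comulLeft (H.T₃ (b ⊗ₜ q))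
      = (φ ∘ₗ LinearMap.mulRight ℂ b).smulRight q := by
    ext a'
    simp [comulLeft_apply, left_comul_T₃, hφ.2.1]
  rw [key, h, lTensor_smulRight_apply, ← sliceRight_lTensor, ← mulLeft_rTensor_T₁,
    sliceRight_rTensor]
  rfl

/-- `(x₁ ⊗ q d₁ x₂) φ(d₂ x₃) = x₁ φ(d x₂) ⊗ q` -/
theorem T₄_slice (d x q : A) :
    H.T₄ ((sliceRight φ ∘ₗ H.T₄.toLinearMap ∘ₗ
      (TensorProduct.mk ℂ A A).flip x).lTensor A (H.T₂ (q ⊗ₜ d)))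
      = sliceRight φ (H.T₄ (d ⊗ₜ x)) ⊗ₜ[ℂ] q := by
  refine H.eq_of_mulRight_rTensor fun t => ?_
  have key : ∀ z : A ⊗[ℂ] A, (LinearMap.mulRight ℂ t).rTensor A
      (H.T₄ ((sliceRight φ ∘ₗ H.T₄.toLinearMap ∘ₗ
        (TensorProduct.mk ℂ A A).flip x).lTensor A z))
      = (sliceRight φ ∘ₗ H.comulRight z).lTensor A (H.T₃ (x ⊗ₜ t)) := by
    intro z
    induction z with
    | zero => simp [comulRight_zero]
    | add x y hx hy => simp_all [comulRight_add, LinearMap.comp_add, LinearMap.lTensor_add]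
    | tmul r s =>
      rw [sliceRight_comulRight_tmul, LinearMap.lTensor_comp_apply A (LinearMap.mulLeft ℂ r), ← T₃_sliceT₄,
        mulLeft_lTensor_T₃]
      rfl
  have h : sliceRight φ ∘ₗ H.comulRight (H.T₂ (q ⊗ₜ d))
      = (φ ∘ₗ LinearMap.mulLeft ℂ d).smulRight q := by
    ext a'
    simp [comulRight_apply, right_comul_T₂, hφ.2.2]
  rw [key, h, lTensor_smulRight_apply, ← sliceRight_lTensor, mulLeft_lTensor_T₃,
    sliceRight_rTensor]
  rfl

/-- The formula `S(a₁) φ(a₂ b) q = b₁ φ(a b₂) q`, before the antipode is known. -/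
theorem sliceLeft_T₁_symm {ε : A →ₗ[ℂ] ℂ} (hε : H.IsCounit ε) (w : A ⊗[ℂ] A) (q : A) :
    sliceLeft ε (H.T₁.symm (sliceRight φ (H.T₁ w) ⊗ₜ q)) = sliceRight φ (H.T₄ w) * q := by
  induction w with
  | zero => simp
  | add x y hx hy => simp_all [TensorProduct.add_tmul, add_mul]
  | tmul a b =>
    rw [← hφ.T₁_slice, LinearEquiv.symm_apply_apply, sliceLeft_comm, sliceRight_lTensor]
    have h : ε ∘ₗ sliceRight φ ∘ₗ H.T₁.toLinearMap ∘ₗ TensorProduct.mk ℂ A A a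
        = φ ∘ₗ LinearMap.mulLeft ℂ a := by
      ext s
      simp [apply_sliceRight, hε.1]
    rw [h, ← sliceRight_lTensor, mulLeft_lTensor_T₃, sliceRight_rTensor]
    rfl

theorem sliceRight_T₄_symm {ε : A →ₗ[ℂ] ℂ} (hε : H.IsCounit ε) (w : A ⊗[ℂ] A) (q : A) :
    sliceRight ε (H.T₄.symm (sliceRight φ (H.T₄ w) ⊗ₜ q)) = q * sliceRight φ (H.T₁ w) := by
  induction w with
  | zero => simp
  | add x y hx hy => simp_all [TensorProduct.add_tmul, mul_add]
  | tmul d x =>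
    rw [← hφ.T₄_slice, LinearEquiv.symm_apply_apply, sliceRight_lTensor]
    have h : ε ∘ₗ sliceRight φ ∘ₗ H.T₄.toLinearMap ∘ₗ (TensorProduct.mk ℂ A A).flip x
        = φ ∘ₗ LinearMap.mulRight ℂ x := by
      ext s
      simp [apply_sliceRight, hε.sliceLeft_T₄]
    rw [h, ← sliceRight_lTensor, ← mulLeft_rTensor_T₁, sliceRight_rTensor]
    rfl

theorem nontrivial : Nontrivial A := by
  by_contra h
  rw [not_nontrivial_iff_subsingleton] at h
  exact hφ.1 (LinearMap.ext fun a => by rw [Subsingleton.elim a 0, map_zero, map_zero])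

/-- The antipode in terms of a left integral: `S(a₁) φ(a₂ b) = b₁ φ(a b₂)`. -/
theorem exists_antipode_formula {ε : A →ₗ[ℂ] ℂ} (hε : H.IsCounit ε) :
    ∃ S : A ≃ₗ[ℂ] A, (∀ w, S (sliceRight φ (H.T₁ w)) = sliceRight φ (H.T₄ w)) ∧
      ∀ p q, S p * q = sliceLeft ε (H.T₁.symm (p ⊗ₜ q)) := by
  have h1 : Function.Surjective (sliceRight φ ∘ₗ H.T₁.toLinearMap) :=
    (sliceRight_surjective hφ.1).comp H.T₁.surjective
  have h4 : Function.Surjective (sliceRight φ ∘ₗ H.T₄.toLinearMap) :=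
    (sliceRight_surjective hφ.1).comp H.T₄.surjective
  -- Equality of kernels makes S well defined and injective at once: by `sliceLeft_T₁_symm` and
  -- `sliceRight_T₄_symm` each slice, multiplied by any q, is a linear function of the other.
  obtain ⟨S, hS⟩ := exists_linearEquiv_of_ker_eq h1 h4 fun w => by
    simp only [LinearMap.comp_apply, LinearEquiv.coe_coe]
    constructor
    · intro h
      refine H.nondegenerate.1 _ fun q => ?_
      rw [← hφ.sliceLeft_T₁_symm hε, h]
      simp
    · intro h
      refine H.nondegenerate.2 _ fun q => ?_
      rw [← hφ.sliceRight_T₄_symm hε, h]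
      simp
  simp only [LinearMap.comp_apply, LinearEquiv.coe_coe] at hS
  refine ⟨S, hS, fun p q => ?_⟩
  obtain ⟨w, rfl⟩ := h1 p
  simp only [LinearMap.comp_apply, LinearEquiv.coe_coe]
  rw [hS, hφ.sliceLeft_T₁_symm hε]

end IsLeftIntegral

/-! ### The antipode -/

section Antipode

variable {H} {ε : A →ₗ[ℂ] ℂ} (hε : H.IsCounit ε) {S : A ≃ₗ[ℂ] A}
include hε

/-- The first antipode identity is the hypothesis read through `T₁`. For the second, multiply by r
and move T₁⁻¹ on legs 2, 3 past `T₂` on legs 1, 2; then (ι ⊗ ε)T₂ is the product, and what remains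
is x times the product of the legs of T₁⁻¹(y ⊗ r), that is ε(y)xr. -/
theorem IsCounit.isAntipode (hS : ∀ p q, S p * q = sliceLeft ε (H.T₁.symm (p ⊗ₜ q))) :
    H.IsAntipode S := by
  have h1 : ∀ z : A ⊗[ℂ] A, LinearMap.mul' ℂ A (S.toLinearMap.rTensor A z)
      = sliceLeft ε (H.T₁.symm z) := fun z => by
    induction z with
    | zero => simp
    | add x y hx hy => simp_all
    | tmul v w => simp [hS]
  refine ⟨ε, hε, fun a b => by simp [h1], fun x y => H.eq_of_mul_right fun r => ?_⟩
  have h := H.coassoc.firstLegs_apply x (H.T₁.symm (y ⊗ₜ r))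
  apply_fun LinearMap.mul' ℂ A ∘ₗ (sliceLeft ε ∘ₗ H.T₁.symm.toLinearMap).lTensor A at h
  simp only [LinearMap.comp_apply] at h
  rw [← LinearMap.lTensor_comp_apply, LinearMap.comp_assoc, LinearEquiv.symm_comp,
    LinearMap.comp_id] at h
  simp only [LinearEquiv.coe_coe, LinearEquiv.apply_symm_apply] at h
  rw [firstLegs_tmul, lTensor_assoc_tmul] at h
  have h2 : ∀ w : A ⊗[ℂ] A, LinearMap.mul' ℂ A (((sliceLeft ε ∘ₗ H.T₁.symm.toLinearMap) ∘ₗ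
      (TensorProduct.mk ℂ A A).flip r).lTensor A w)
      = LinearMap.mul' ℂ A (S.toLinearMap.lTensor A w) * r := fun w => by
    induction w with
    | zero => simp
    | add x y hx hy => simp_all [add_mul]
    | tmul v w => simp [← hS, mul_assoc]
  have h3 : ∀ z : A ⊗[ℂ] A, LinearMap.mul' ℂ A ((sliceLeft ε).lTensor A
      (firstLegs H.T₂.toLinearMap x z)) = x * LinearMap.mul' ℂ A z := fun z => by
    induction z with
    | zero => simp
    | add x y hx hy => simp_all [mul_add]
    | tmul u v =>
      rw [firstLegs_tmul, lTensor_assoc_tmul]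
      have : sliceLeft ε ∘ₗ (TensorProduct.mk ℂ A A).flip v = ε.smulRight v := by
        ext; simp
      rw [this, lTensor_smulRight_apply, LinearEquiv.coe_coe, hε.2]
      simp [mul_assoc]
  rw [h2, h3, ← hε.sliceLeft_T₁ (H.T₁.symm _)] at h
  refine h.trans ?_
  simp [smul_mul_assoc, mul_smul_comm]

end Antipode

namespace IsAntipode

variable {H} {S : A ≃ₗ[ℂ] A} {ε : A →ₗ[ℂ] ℂ}

/-- As `T₁` is bijective, the first antipode identity alone determines S; uniqueness follows. -/
theorem apply_mul [Nontrivial A] (hS : H.IsAntipode S) (hε : H.IsCounit ε) (p q : A) :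
    S p * q = sliceLeft ε (H.T₁.symm (p ⊗ₜ q)) := by
  obtain ⟨ε', hε', h, -⟩ := hS
  obtain rfl := hε.unique hε'
  have key : ∀ z : A ⊗[ℂ] A, LinearMap.mul' ℂ A (S.toLinearMap.rTensor A (H.T₁ z))
      = sliceLeft ε z := fun z => by
    induction z with
    | zero => simp
    | add x y hx hy => simp_all
    | tmul v w => simp [h]
  have := key (H.T₁.symm (p ⊗ₜ q))
  simpa using this

theorem unique [Nontrivial A] {S' : A ≃ₗ[ℂ] A} (hS : H.IsAntipode S) (hS' : H.IsAntipode S') :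
    S = S' := by
  obtain ⟨ε, hε, -⟩ := id hS
  ext p
  exact H.eq_of_mul_right fun q => by rw [hS.apply_mul hε, hS'.apply_mul hε]

/-- The antipode is an anti-homomorphism. -/
theorem map_mul [Nontrivial A] (hS : H.IsAntipode S) (p p' : A) : S (p * p') = S p' * S p := by
  obtain ⟨ε, hε, -⟩ := id hS
  refine H.eq_of_mul_right fun q => ?_
  have h1 : ∀ z : A ⊗[ℂ] A, LinearMap.mul' ℂ A (S.toLinearMap.rTensor A (H.T₁ z))
      = sliceLeft ε z := fun z => by
    have : ∀ y : A ⊗[ℂ] A, LinearMap.mul' ℂ A (S.toLinearMap.rTensor A y)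
        = sliceLeft ε (H.T₁.symm y) := fun y => by
      induction y with
      | zero => simp
      | add x y hx hy => simp_all
      | tmul v w => simp [hS.apply_mul hε]
    rw [this, LinearEquiv.symm_apply_apply]
  -- `p ⊗ q = a₁ ⊗ a₂ b` and `p' ⊗ b = a'₁ ⊗ a'₂ b'`
  have h2 : ∀ a : A, ∀ w : A ⊗[ℂ] A, ∀ y : A ⊗[ℂ] A, y = H.T₁ w →
      LinearMap.mul' ℂ A (S.toLinearMap.rTensor A (left (H.comul a) y))
        = ε a • sliceLeft ε w := by
    rintro a w _ rfl
    rw [left_comul_T₁, h1, sliceLeft_rTensor]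
    have : ε ∘ₗ LinearMap.mulLeft ℂ a = ε a • ε := by
      ext x
      simp [hε.map_mul]
    rw [this]
    clear * -
    induction w with
    | zero => simp
    | add x y hx hy => simp_all
    | tmul v w => simp [smul_smul]
  -- Taken at T₁(w) = p ⊗ q, this reads S(pp')q = S(p')S(p)q. On w = a ⊗ b it is `h2` for Δ(a)(p' ⊗
  -- b), which uses that ε is multiplicative.
  have h3 : ∀ w : A ⊗[ℂ] A, LinearMap.mul' ℂ A (S.toLinearMap.rTensor A
      ((LinearMap.mulRight ℂ p').rTensor A (H.T₁ w))) = S p' * sliceLeft ε w := fun w => by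
    induction w with
    | zero => simp
    | add x y hx hy => simp_all [mul_add]
    | tmul a b =>
      rw [← left_comul_tmul, h2 a (H.T₁.symm (p' ⊗ₜ b)) _ (by simp), ← hS.apply_mul hε]
      simp [mul_smul_comm]
  have h := h3 (H.T₁.symm (p ⊗ₜ q))
  rw [← hS.apply_mul hε] at h
  simpa [mul_assoc] using h

end IsAntipode

namespace IsLeftIntegral

variable {H} {φ : A →ₗ[ℂ] ℂ} (hφ : H.IsLeftIntegral φ)
include hφ

theorem isAntipode_antipode : H.IsAntipode H.antipode := by
  have := hφ.nontrivial
  obtain ⟨ε, hε⟩ := H.exists_counit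
  obtain ⟨S, -, hS⟩ := hφ.exists_antipode_formula hε
  exact Classical.epsilon_spec ⟨S, hε.isAntipode hS⟩

/-- `S(a₁) φ(a₂ b) = b₁ φ(a b₂)` -/
theorem antipode_sliceRight (w : A ⊗[ℂ] A) :
    H.antipode (sliceRight φ (H.T₁ w)) = sliceRight φ (H.T₄ w) := by
  have := hφ.nontrivial
  obtain ⟨ε, hε⟩ := H.exists_counit
  obtain ⟨S, hS', hS⟩ := hφ.exists_antipode_formula hε
  rw [hφ.isAntipode_antipode.unique (hε.isAntipode hS), hS']

end IsLeftIntegral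

end RegularMultiplierHopfAlgebra

/-- `ω ↦ (ι ⊗ ω)(z)` -/
def sliceRightFlip {V W : Type*} [AddCommGroup V] [Module ℂ V] [AddCommGroup W] [Module ℂ W]
    (z : V ⊗[ℂ] W) : (W →ₗ[ℂ] ℂ) →ₗ[ℂ] V where
  toFun ω := sliceRight ω z
  map_add' ω ω' := by simp [sliceRight, LinearMap.lTensor_add]
  map_smul' r ω := by simp [sliceRight, LinearMap.lTensor_smul]

theorem sliceRightFlip_apply {V W : Type*} [AddCommGroup V] [Module ℂ V] [AddCommGroup W]
    [Module ℂ W] (z : V ⊗[ℂ] W) (ω : W →ₗ[ℂ] ℂ) : sliceRightFlip z ω = sliceRight ω z := rfl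

/-- Linear maps that agree up to surjective reparametrizations have equal ranges. -/
theorem range_eq_of_comp {X A Y : Type*} [AddCommGroup A] [Module ℂ A]
    [AddCommGroup Y] [Module ℂ Y] {f g : A →ₗ[ℂ] Y} (s t : X → A) (hs : Function.Surjective s)
    (ht : Function.Surjective t) (h : ∀ x, f (s x) = g (t x)) :
    LinearMap.range f = LinearMap.range g := by
  ext y
  constructor
  · rintro ⟨a, rfl⟩
    obtain ⟨x, rfl⟩ := hs a
    exact ⟨t x, (h x).symm⟩
  · rintro ⟨a, rfl⟩
    obtain ⟨x, rfl⟩ := ht a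
    exact ⟨s x, h x⟩

theorem RegularMultiplierHopfAlgebra.right_comul_T₄ {A : Type*} [NonUnitalRing A] [Module ℂ A]
    [IsScalarTower ℂ A A] [SMulCommClass ℂ A A] (H : RegularMultiplierHopfAlgebra A)
    (a : A) (z : A ⊗[ℂ] A) :
    right (H.comul a) (H.T₄ z) = H.T₄ ((LinearMap.mulRight ℂ a).lTensor A z) := by
  induction z with
  | zero => simp
  | add x y hx hy => simp_all
  | tmul v w =>
    apply H.embed_tensor_injective
    rw [← embed_mul, LinearMap.lTensor_tmul, H.embed_T₄, H.embed_T₄, LinearMap.mulRight_apply,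
      map_mul, mul_assoc]

namespace AlgebraicQuantumGroup

open RegularMultiplierHopfAlgebra

variable {A : Type*} [NonUnitalRing A] [Module ℂ A] [IsScalarTower ℂ A A] [SMulCommClass ℂ A A]
variable (G : AlgebraicQuantumGroup A)

theorem nontrivial (G : AlgebraicQuantumGroup A) : Nontrivial A := G.isLeftIntegral_φ.nontrivial

theorem isAntipode_S : G.IsAntipode G.S := G.isLeftIntegral_φ.isAntipode_antipode

theorem S_mul (a b : A) : G.S (a * b) = G.S b * G.S a :=
  have := G.nontrivial
  G.isAntipode_S.map_mul a b

/-- `S(a₁) φ(a₂ b) = b₁ φ(a b₂)` -/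
theorem S_sliceRight_T₁ (w : A ⊗[ℂ] A) :
    G.S (sliceRight G.φ (G.T₁ w)) = sliceRight G.φ (G.T₄ w) :=
  G.isLeftIntegral_φ.antipode_sliceRight w

theorem ψ_apply (a : A) : G.ψ a = G.φ (G.S a) := rfl

theorem ψ_ne_zero : G.ψ ≠ 0 := fun h => G.isLeftIntegral_φ.1 <| LinearMap.ext fun a => by
  simpa [ψ_apply] using LinearMap.congr_fun h (G.S.symm a)

/-! ### The antipode reverses the coproduct -/

/-- `a ⊗ b ↦ S(b) ⊗ S(a)` -/
def flipS : A ⊗[ℂ] A →ₗ[ℂ] A ⊗[ℂ] A :=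
  (TensorProduct.comm ℂ A A).toLinearMap ∘ₗ TensorProduct.map G.S.toLinearMap G.S.toLinearMap

@[simp] theorem flipS_tmul (a b : A) : G.flipS (a ⊗ₜ b) = G.S b ⊗ₜ G.S a := rfl

theorem flipS_mulLeft_rTensor (t : A) (z : A ⊗[ℂ] A) :
    G.flipS ((LinearMap.mulLeft ℂ t).rTensor A z)
      = (LinearMap.mulRight ℂ (G.S t)).lTensor A (G.flipS z) := by
  induction z with
  | zero => simp
  | add x y hx hy => simp_all
  | tmul v w => simp [S_mul]

theorem flipS_mulRight_rTensor (t : A) (z : A ⊗[ℂ] A) :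
    G.flipS ((LinearMap.mulRight ℂ t).rTensor A z)
      = (LinearMap.mulLeft ℂ (G.S t)).lTensor A (G.flipS z) := by
  induction z with
  | zero => simp
  | add x y hx hy => simp_all
  | tmul v w => simp [S_mul]

theorem flipS_mulLeft_lTensor (t : A) (z : A ⊗[ℂ] A) :
    G.flipS ((LinearMap.mulLeft ℂ t).lTensor A z)
      = (LinearMap.mulRight ℂ (G.S t)).rTensor A (G.flipS z) := by
  induction z with
  | zero => simp
  | add x y hx hy => simp_all
  | tmul v w => simp [S_mul]

theorem flipS_mulRight_lTensor (t : A) (z : A ⊗[ℂ] A) :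
    G.flipS ((LinearMap.mulRight ℂ t).lTensor A z)
      = (LinearMap.mulLeft ℂ (G.S t)).rTensor A (G.flipS z) := by
  induction z with
  | zero => simp
  | add x y hx hy => simp_all
  | tmul v w => simp [S_mul]

theorem sliceRight_flipS (f : A →ₗ[ℂ] ℂ) (z : A ⊗[ℂ] A) :
    sliceRight f (G.flipS z) = G.S (sliceLeft (f ∘ₗ G.S.toLinearMap) z) := by
  induction z with
  | zero => simp
  | add x y hx hy => simp_all
  | tmul v w => simp

theorem sliceLeft_flipS (f : A →ₗ[ℂ] ℂ) (z : A ⊗[ℂ] A) :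
    sliceLeft f (G.flipS z) = G.S (sliceRight (f ∘ₗ G.S.toLinearMap) z) := by
  induction z with
  | zero => simp
  | add x y hx hy => simp_all
  | tmul v w => simp

/-- Both sides are p₁ ⊗ S(b)q₁φ(p₂q₂): on the left, S(p₂)φ(p₃q) = q₁φ(p₂q₂) is applied inside Δ²(p).
This is the first half of `flipS_T₁`, for a written as p₁φ(p₂q). -/
theorem lTensor_S_T₁ (p q b : A) :
    G.S.toLinearMap.lTensor A (G.T₁ (G.sliceT₁ G.φ q p ⊗ₜ b))
      = TensorProduct.comm ℂ A A ((sliceRight G.φ ∘ₗ G.T₁.toLinearMap ∘ₗ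
          TensorProduct.mk ℂ A A p).lTensor A (G.T₂ (G.S b ⊗ₜ q))) := by
  refine G.eq_of_mulLeft_rTensor fun t => ?_
  have key : ∀ z : A ⊗[ℂ] A, (LinearMap.mulLeft ℂ t).rTensor A
      (TensorProduct.comm ℂ A A ((sliceRight G.φ ∘ₗ G.T₁.toLinearMap ∘ₗ
          TensorProduct.mk ℂ A A p).lTensor A z))
      = (sliceRightFlip z ∘ₗ mulLeftFunctional G.φ).lTensor A (G.T₂ (t ⊗ₜ p)) := by
    intro z
    induction z with
    | zero =>
      have : sliceRightFlip (0 : A ⊗[ℂ] A) = 0 := by ext; simp [sliceRightFlip_apply]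
      simp [this]
    | add x y hx hy =>
      have : sliceRightFlip (x + y) = sliceRightFlip x + sliceRightFlip y := by
        ext; simp [sliceRightFlip_apply]
      simp_all [LinearMap.add_comp, LinearMap.lTensor_add]
    | tmul r s =>
      have : sliceRightFlip (r ⊗ₜ[ℂ] s) ∘ₗ mulLeftFunctional G.φ
          = (G.φ ∘ₗ LinearMap.mulRight ℂ s).smulRight r := by
        ext; simp [sliceRightFlip_apply]
      rw [this, lTensor_smulRight_apply, ← sliceRight_lTensor, ← mulLeft_rTensor_T₁,
        sliceRight_rTensor]
      rfl
  rw [key, rTensor_lTensor_apply, mulLeft_rTensor_T₁, T₂_sliceT₁, ← LinearMap.lTensor_comp_apply,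
    ← LinearMap.lTensor_comp_apply]
  congr 2
  ext p'
  have h : G.S.toLinearMap ((LinearMap.mulRight ℂ b) (G.sliceT₁ G.φ q p'))
      = G.S b * sliceRight G.φ (G.T₄ (p' ⊗ₜ q)) := by
    simp [S_mul, S_sliceRight_T₁]
  refine h.trans ?_
  change LinearMap.mulLeft ℂ _ _ = _
  rw [← sliceRight_rTensor, ← mulLeft_lTensor_T₂, sliceRight_lTensor]
  rfl

/-- `Δ(S(a)) = S(a₂) ⊗ S(a₁)` -/
theorem flipS_T₁ (a b : A) : G.flipS (G.T₁ (a ⊗ₜ b)) = G.T₂ (G.S b ⊗ₜ G.S a) := by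
  obtain ⟨w, rfl⟩ := ((sliceRight_surjective (V := A) G.isLeftIntegral_φ.1).comp
    G.T₁.surjective) a
  simp only [Function.comp_apply]
  induction w with
  | zero => simp
  | add x y hx hy => simp_all [TensorProduct.add_tmul, TensorProduct.tmul_add]
  | tmul p q =>
    have h : ∀ z : A ⊗[ℂ] A, G.flipS z = TensorProduct.comm ℂ A A
        (G.S.toLinearMap.rTensor A (G.S.toLinearMap.lTensor A z)) := fun z => by
      induction z with
      | zero => simp
      | add x y hx hy => simp_all
      | tmul v w => simp
    rw [h]
    have h' := G.lTensor_S_T₁ p q b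
    rw [sliceT₁_apply] at h'
    -- The other leg uses the same formula again, S(p₁)φ(p₂q₂) = q₂φ(pq₃), which leaves S(b)q₁ ⊗
    -- q₂φ(pq₃).
    rw [h', ← comm_lTensor, ← LinearMap.lTensor_comp_apply, S_sliceRight_T₁, ← sliceT₄_apply,
      T₂_sliceT₄]
    have h'' : ∀ z : A ⊗[ℂ] A, TensorProduct.comm ℂ A A (TensorProduct.comm ℂ A A z) = z :=
      fun z => by simp
    rw [h'']
    congr 2
    ext s
    simp [S_sliceRight_T₁]

theorem flipS_T₂ (b a : A) : G.flipS (G.T₂ (b ⊗ₜ a)) = G.T₁ (G.S a ⊗ₜ G.S b) := by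
  refine G.eq_of_mulLeft_rTensor fun t => ?_
  obtain ⟨t, rfl⟩ := G.S.surjective t
  rw [← flipS_mulRight_lTensor, ← mulLeft_rTensor_T₁, flipS_mulLeft_rTensor, flipS_T₁,
    ← mulLeft_rTensor_T₁]

theorem flipS_T₄ (b a : A) : G.flipS (G.T₄ (b ⊗ₜ a)) = G.T₃ (G.S a ⊗ₜ G.S b) := by
  refine G.eq_of_mulRight_lTensor fun t => ?_
  obtain ⟨t, rfl⟩ := G.S.surjective t
  rw [← flipS_mulLeft_rTensor, ← mulLeft_lTensor_T₂, flipS_mulLeft_lTensor, flipS_T₂,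
    ← mulRight_rTensor_T₁]

theorem flipS_T₃ (a b : A) : G.flipS (G.T₃ (a ⊗ₜ b)) = G.T₄ (G.S b ⊗ₜ G.S a) := by
  refine G.eq_of_mulRight_lTensor fun t => ?_
  obtain ⟨t, rfl⟩ := G.S.surjective t
  rw [← flipS_mulLeft_rTensor, mulLeft_rTensor_T₃, flipS_mulRight_rTensor, flipS_T₂,
    mulLeft_lTensor_T₁]

/-! ### The right integral and faithfulness -/

/-- S reverses Δ, so slicing the second leg of the flipped identities by φ turns left invariance of
φ into right invariance of φ ∘ S. -/
theorem isRightIntegral_ψ : G.IsRightIntegral G.ψ := by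
  refine ⟨G.ψ_ne_zero, fun a b => G.S.injective ?_, fun a b => G.S.injective ?_⟩
  · have h := congrArg (sliceRight G.φ) (G.flipS_T₁ a b)
    rw [sliceRight_flipS, G.isLeftIntegral_φ.2.2] at h
    rw [map_smul, ψ_apply, ← h]
    rfl
  · have h := congrArg (sliceRight G.φ) (G.flipS_T₄ b a)
    rw [sliceRight_flipS, G.isLeftIntegral_φ.2.1] at h
    rw [map_smul, ψ_apply, ← h]
    rfl

/-- `ψ(x₁ c) x₂ = ψ(x c₁) S(c₂)` -/
theorem S_sliceLeft_T₂ (x c : A) :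
    G.S (sliceLeft G.ψ (G.T₂ (x ⊗ₜ c))) = sliceLeft G.ψ (G.T₃ (x ⊗ₜ c)) := by
  apply G.S.injective
  have h := G.S_sliceRight_T₁ (G.S c ⊗ₜ G.S x)
  rw [← flipS_T₂, ← flipS_T₃, sliceRight_flipS, sliceRight_flipS] at h
  exact h

/-- `S(n₁ x) n₂ = ε(n) S(x)` -/
theorem mul'_rTensor_S_T₃ {ε : A →ₗ[ℂ] ℂ} (hε : G.IsCounit ε) (n x : A) :
    LinearMap.mul' ℂ A (G.S.toLinearMap.rTensor A (G.T₃ (n ⊗ₜ x))) = ε n • G.S x := by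
  have := G.nontrivial
  refine G.eq_of_mul_right fun y => ?_
  have h1 : ∀ z : A ⊗[ℂ] A, LinearMap.mul' ℂ A (G.S.toLinearMap.rTensor A z) * y
      = LinearMap.mul' ℂ A (G.S.toLinearMap.rTensor A
        ((LinearMap.mulRight ℂ y).lTensor A z)) := fun z => by
    induction z with
    | zero => simp
    | add x y hx hy => simp_all [add_mul]
    | tmul v w => simp [mul_assoc]
  have h2 : ∀ z : A ⊗[ℂ] A, LinearMap.mul' ℂ A (G.S.toLinearMap.rTensor A
      ((LinearMap.mulRight ℂ x).rTensor A z))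
      = G.S x * LinearMap.mul' ℂ A (G.S.toLinearMap.rTensor A z) := fun z => by
    induction z with
    | zero => simp
    | add x y hx hy => simp_all [mul_add]
    | tmul v w => simp [mul_assoc, S_mul]
  obtain ⟨ε', hε', h3, -⟩ := G.isAntipode_S
  obtain rfl := hε.unique hε'
  rw [h1, ← mulRight_rTensor_T₁, h2, h3, mul_smul_comm, smul_mul_assoc]

/-- The left integral is faithful. -/
theorem φ_faithful {n : A} (hn : ∀ x, G.φ (x * n) = 0) : n = 0 := by
  have := G.nontrivial
  obtain ⟨ε, hε⟩ := G.exists_counit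
  -- The second leg of Δ(n)(x ⊗ 1) stays in the left ideal {n | φ(· n) = 0}, because n₁φ(yn₂) =
  -- S(y₁)φ(y₂n) = 0.
  have h1 : ∀ n : A, (∀ x, G.φ (x * n) = 0) → ∀ x, (mulRightFunctional G.φ).lTensor A
      (G.T₃ (n ⊗ₜ x)) = 0 := fun n hn x => by
    refine eq_zero_of_sliceLeft _ fun ω => LinearMap.ext fun y => ?_
    have h2 : sliceRight G.φ (G.T₄ (y ⊗ₜ n)) = 0 := by
      rw [← S_sliceRight_T₁]
      have h : sliceRight G.φ (G.T₁ (y ⊗ₜ n)) = 0 := by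
        refine G.nondegenerate.2 _ fun t => ?_
        change LinearMap.mulLeft ℂ t _ = 0
        rw [← sliceRight_rTensor, mulLeft_rTensor_T₁, sliceRight_lTensor]
        have : G.φ ∘ₗ LinearMap.mulRight ℂ n = 0 := LinearMap.ext fun x => by simp [hn]
        rw [this]
        simp [sliceRight]
      rw [h, map_zero]
    rw [sliceLeft_lTensor]
    change G.φ (LinearMap.mulLeft ℂ y _) = 0
    rw [← sliceLeft_lTensor, mulLeft_lTensor_T₃, ← apply_sliceRight, sliceRight_rTensor, h2]
    simp
  -- If ε(n) ≠ 0, then ε(n)φ(yS(x)) = φ(yS(n₁x)n₂) = 0 makes φ vanish on all products, and these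
  -- span A.
  have h3 : ∀ n : A, (∀ x, G.φ (x * n) = 0) → ε n = 0 := fun n hn => by
    by_contra hne
    have h4 : ∀ y x, G.φ (y * x) = 0 := fun y x => by
      obtain ⟨x, rfl⟩ := G.S.surjective x
      have h5 : ∀ z : A ⊗[ℂ] A, G.φ (y * LinearMap.mul' ℂ A (G.S.toLinearMap.rTensor A z))
          = TensorProduct.lift ((LinearMap.applyₗ ∘ₗ LinearMap.mulLeft ℂ y ∘ₗ
            G.S.toLinearMap : A →ₗ[ℂ] (A →ₗ[ℂ] ℂ) →ₗ[ℂ] ℂ))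
            ((mulRightFunctional G.φ).lTensor A z) := fun z => by
        induction z with
        | zero => simp
        | add x y hx hy => simp_all [mul_add]
        | tmul v w => simp [mul_assoc]
      have h6 := h5 (G.T₃ (n ⊗ₜ x))
      rw [h1 n hn, mul'_rTensor_S_T₃ _ hε, map_zero, mul_smul_comm, map_smul] at h6
      exact (smul_eq_zero.1 h6).resolve_left hne
    refine G.isLeftIntegral_φ.1 (LinearMap.ext fun a => ?_)
    obtain ⟨z, rfl⟩ := hε.mul'_surjective a
    induction z with
    | zero => simp
    | add x y hx hy => simp_all
    | tmul v w => simp [h4]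
  refine G.nondegenerate.1 _ fun x => ?_
  rw [← hε.sliceRight_T₃]
  -- Each slice (ω ⊗ ι)(Δ(n)(x ⊗ 1)) lies in the ideal, where ε vanishes; hence nx = 0.
  have h7 : ∀ ω : A →ₗ[ℂ] ℂ, ω (sliceRight ε (G.T₃ (n ⊗ₜ x))) = 0 := fun ω => by
    rw [apply_sliceRight]
    refine h3 _ fun y => ?_
    have h8 := congrArg (sliceLeft ω) (h1 n hn x)
    rw [sliceLeft_lTensor, map_zero] at h8
    exact LinearMap.congr_fun h8 y
  exact (Module.forall_dual_apply_eq_zero_iff ℂ _).1 h7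

/-! ### Descriptions of the dual -/

/-- Both sides are (ψ ⊗ φ)(Δ(x)z): right invariance of ψ evaluates it through `T₁`, left invariance
of φ through `T₃`. The next lemma does the same with zΔ(x). -/
theorem ψ_mul_sliceRight (x : A) (z : A ⊗[ℂ] A) :
    G.ψ (x * sliceRight G.φ (G.T₁.symm z)) = G.φ (x * sliceRight G.ψ (G.T₃.symm z)) := by
  have h1 : ∀ w, G.ψ (x * sliceRight G.φ w) = G.φ (sliceLeft G.ψ (left (G.comul x) (G.T₁ w))) :=
    fun w => by
      rw [left_comul_T₁]
      induction w with
      | zero => simp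
      | add x y hx hy => simp_all [mul_add]
      | tmul p q => simp [G.isRightIntegral_ψ.2.1, mul_smul_comm, mul_comm]
  have h2 : ∀ w, G.φ (x * sliceRight G.ψ w) = G.ψ (sliceRight G.φ (left (G.comul x) (G.T₃ w))) :=
    fun w => by
      rw [left_comul_T₃]
      induction w with
      | zero => simp
      | add x y hx hy => simp_all [mul_add]
      | tmul p q => simp [G.isLeftIntegral_φ.2.1, mul_smul_comm, mul_comm]
  rw [h1, h2, LinearEquiv.apply_symm_apply, LinearEquiv.apply_symm_apply, apply_sliceRight]

theorem ψ_sliceLeft_mul (x : A) (z : A ⊗[ℂ] A) :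
    G.ψ (sliceLeft G.φ (G.T₄.symm z) * x) = G.φ (sliceLeft G.ψ (G.T₂.symm z) * x) := by
  have h1 : ∀ w, G.ψ (sliceLeft G.φ w * x) = G.φ (sliceLeft G.ψ (right (G.comul x) (G.T₄ w))) :=
    fun w => by
      rw [right_comul_T₄]
      induction w with
      | zero => simp
      | add x y hx hy => simp_all [add_mul]
      | tmul p q => simp [G.isRightIntegral_ψ.2.2, smul_mul_assoc, mul_comm]
  have h2 : ∀ w, G.φ (sliceLeft G.ψ w * x) = G.ψ (sliceRight G.φ (right (G.comul x) (G.T₂ w))) :=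
    fun w => by
      rw [right_comul_T₂]
      induction w with
      | zero => simp
      | add x y hx hy => simp_all [add_mul]
      | tmul p q => simp [G.isLeftIntegral_φ.2.2, smul_mul_assoc, mul_comm]
  rw [h1, h2, LinearEquiv.apply_symm_apply, LinearEquiv.apply_symm_apply, apply_sliceRight]

/-- The link between functionals c · and · c. For w = c ⊗ d both sides equal φ(S(d)x₂)ψ(x₁S(c)), the
left one by the antipode formula for φ and the right one by that for ψ. -/
theorem φ_mul_eq_ψ_mul (x : A) (w : A ⊗[ℂ] A) :
    G.φ (sliceLeft (G.ψ ∘ₗ G.S.toLinearMap) (G.T₂ (G.S.toLinearMap.lTensor A w)) * x)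
      = G.ψ (x * sliceRight G.ψ (G.T₁ (G.S.toLinearMap.rTensor A w))) := by
  induction w with
  | zero => simp
  | add x y hx hy => simp_all [add_mul, mul_add]
  | tmul c d =>
    simp only [LinearMap.lTensor_tmul, LinearMap.rTensor_tmul, LinearEquiv.coe_coe]
    trans G.φ (G.S d * sliceLeft G.ψ (G.T₃ (x ⊗ₜ G.S c)))
    · trans G.ψ (G.S (c * sliceRight G.φ (G.T₁ (G.S d ⊗ₜ x))))
      · change G.φ (LinearMap.mulRight ℂ x _) = G.ψ (G.S (LinearMap.mulLeft ℂ c _))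
        rw [← sliceLeft_lTensor, ← sliceRight_rTensor, mulLeft_rTensor_T₁, ← apply_sliceRight]
        rfl
      · rw [S_mul, S_sliceRight_T₁]
        change G.ψ (LinearMap.mulRight ℂ _ _) = G.φ (LinearMap.mulLeft ℂ _ _)
        rw [← sliceLeft_lTensor, ← sliceRight_rTensor, mulLeft_lTensor_T₃, apply_sliceRight]
    · rw [← S_sliceLeft_T₂, ← S_mul, ← ψ_apply]
      change G.ψ (LinearMap.mulRight ℂ _ _) = G.ψ (LinearMap.mulLeft ℂ _ _)
      rw [← sliceLeft_lTensor, ← sliceRight_rTensor, mulLeft_rTensor_T₁, apply_sliceRight]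

theorem range_mulRightFunctional_ψ :
    LinearMap.range (mulRightFunctional G.ψ) = G.dualSubmodule :=
  range_eq_of_comp (fun z => sliceRight G.φ (G.T₁.symm z)) (fun z => sliceRight G.ψ (G.T₃.symm z))
    ((sliceRight_surjective G.isLeftIntegral_φ.1).comp G.T₁.symm.surjective)
    ((sliceRight_surjective G.ψ_ne_zero).comp G.T₃.symm.surjective)
    fun z => LinearMap.ext fun x => G.ψ_mul_sliceRight x z

theorem range_mulLeftFunctional_φ :
    LinearMap.range (mulLeftFunctional G.φ) = G.dualSubmodule := by
  have hne : G.ψ ∘ₗ G.S.toLinearMap ≠ 0 := fun h => G.ψ_ne_zero <| LinearMap.ext fun a => by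
    simpa using LinearMap.congr_fun h (G.S.symm a)
  rw [← range_mulRightFunctional_ψ]
  refine range_eq_of_comp
    (fun w => sliceLeft (G.ψ ∘ₗ G.S.toLinearMap) (G.T₂ (G.S.toLinearMap.lTensor A w)))
    (fun w => sliceRight G.ψ (G.T₁ (G.S.toLinearMap.rTensor A w)))
    ((sliceLeft_surjective hne).comp (G.T₂.surjective.comp ?_))
    ((sliceRight_surjective G.ψ_ne_zero).comp (G.T₁.surjective.comp ?_))
    fun w => LinearMap.ext fun x => G.φ_mul_eq_ψ_mul x w
  · exact LinearMap.lTensor_surjective _ G.S.surjective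
  · exact LinearMap.rTensor_surjective _ G.S.surjective

theorem range_mulLeftFunctional_ψ :
    LinearMap.range (mulLeftFunctional G.ψ) = G.dualSubmodule := by
  rw [← range_mulLeftFunctional_φ]
  exact range_eq_of_comp (fun z => sliceLeft G.φ (G.T₄.symm z))
    (fun z => sliceLeft G.ψ (G.T₂.symm z))
    ((sliceLeft_surjective G.isLeftIntegral_φ.1).comp G.T₄.symm.surjective)
    ((sliceLeft_surjective G.ψ_ne_zero).comp G.T₂.symm.surjective)
    fun z => LinearMap.ext fun x => G.ψ_sliceLeft_mul x z

/-! ### The antipode of the dual -/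

/-- φ(S(x)c) = ψ(S⁻¹(c)x), so the transpose of S carries the functionals φ(· c) onto the functionals
ψ(c ·), which again form B. -/
theorem isDualAntipode_dualS : G.IsDualAntipode G.dualS := by
  have h : G.dualSubmodule.map G.S.dualMap.toLinearMap = G.dualSubmodule := by
    have h1 : G.S.dualMap.toLinearMap ∘ₗ mulRightFunctional G.φ
        = mulLeftFunctional G.ψ ∘ₗ G.S.symm.toLinearMap := by
      ext c x
      simp [ψ_apply, S_mul]
    rw [dualSubmodule, ← LinearMap.range_comp, h1,
      LinearMap.range_comp_of_range_eq_top _ (LinearEquiv.range _), range_mulLeftFunctional_ψ]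
    rfl
  exact Classical.epsilon_spec (p := G.IsDualAntipode)
    ⟨G.S.dualMap.ofSubmodules G.dualSubmodule G.dualSubmodule h, fun a b => rfl⟩

end AlgebraicQuantumGroup

/-! ### Multipliers from extended pairings -/

section ExtendedPairing

variable {C D : Type*} [NonUnitalRing C] [Module ℂ C] [IsScalarTower ℂ C C]
  [SMulCommClass ℂ C C] [AddCommGroup D] [Module ℂ D] {p : C →ₗ[ℂ] D →ₗ[ℂ] ℂ}

/-- A multiplier is determined by its extended pairing. -/
theorem IsExtendedPairing.unique (hp : ∀ x, (∀ y, p x y = 0) → x = 0)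
    (hl : ∀ x y, ∃ y', ∀ x', p x' y' = p (x' * x) y)
    (hr : ∀ x y, ∃ y', ∀ x', p x' y' = p (x * x') y) {f : D →ₗ[ℂ] ℂ}
    {m n : MultiplierAlgebra C} (hm : IsExtendedPairing p m f) (hn : IsExtendedPairing p n f) :
    m = n := by
  ext x <;> rw [← sub_eq_zero] <;> refine hp _ fun y => ?_ <;>
    rw [map_sub, LinearMap.sub_apply, sub_eq_zero]
  · obtain ⟨y', hy'⟩ := hl x y
    rw [← hm.1 x y y' hy', ← hn.1 x y y' hy']
  · obtain ⟨y', hy'⟩ := hr x y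
    rw [← hm.2 x y y' hy', ← hn.2 x y y' hy']

/-- Maps `L` and `R` with `f (x ▷ y) = ⟨L x, y⟩` and `f (y ◁ x) = ⟨R x, y⟩` form a multiplier. -/
theorem exists_isExtendedPairing (hp : ∀ x, (∀ y, p x y = 0) → x = 0)
    (hq : ∀ y, (∀ x, p x y = 0) → y = 0) (f : D →ₗ[ℂ] ℂ) (L R : C →ₗ[ℂ] C)
    (hL : ∀ x y, ∃ y', (∀ x', p x' y' = p (x' * x) y) ∧ f y' = p (L x) y)
    (hR : ∀ x y, ∃ y', (∀ x', p x' y' = p (x * x') y) ∧ f y' = p (R x) y) :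
    ∃ m : MultiplierAlgebra C, IsExtendedPairing p m f ∧ left m = L ∧ right m = R := by
  have hp' : ∀ {x x'}, (∀ y, p x y = p x' y) → x = x' := fun {x x'} h => by
    rw [← sub_eq_zero]
    exact hp _ fun y => by rw [map_sub, LinearMap.sub_apply, h, sub_self]
  have hq' : ∀ {y y'}, (∀ x, p x y = p x y') → y = y' := fun {y y'} h => by
    rw [← sub_eq_zero]
    exact hq _ fun x => by rw [map_sub, h, sub_self]
  -- Non-degeneracy in D makes x ▷ y unique, so the value of f on one choice is its value on all.
  have hL' : ∀ x y y', (∀ x', p x' y' = p (x' * x) y) → f y' = p (L x) y := fun x y y' h => by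
    obtain ⟨z, hz, hz'⟩ := hL x y
    rw [← hz', hq' fun x' => (h x').trans (hz x').symm]
  have hR' : ∀ x y y', (∀ x', p x' y' = p (x * x') y) → f y' = p (R x) y := fun x y y' h => by
    obtain ⟨z, hz, hz'⟩ := hR x y
    rw [← hz', hq' fun x' => (h x').trans (hz x').symm]
  refine ⟨⟨(L, MulOpposite.op R), fun x x' => hp' fun y => ?_, fun x x' => hp' fun y => ?_,
    fun x x' => hp' fun y => ?_⟩, ⟨hL', hR'⟩, rfl, rfl⟩
  · change p (L (x * x')) y = p (L x * x') y
    obtain ⟨y', hy', -⟩ := hL x' y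
    obtain ⟨y'', hy'', -⟩ := hL x y'
    rw [← hy', ← hL' x y' y'' hy'', hL' (x * x') y y'']
    exact fun z => by rw [hy'', hy', mul_assoc]
  · change p (R (x * x')) y = p (x * R x') y
    obtain ⟨y', hy', -⟩ := hR x y
    obtain ⟨y'', hy'', -⟩ := hR x' y'
    rw [← hy', ← hR' x' y' y'' hy'', hR' (x * x') y y'']
    exact fun z => by rw [hy'', hy', mul_assoc]
  -- Both numbers are the value of f at x' ▷ (y ◁ x) = (x' ▷ y) ◁ x.
  · change p (R x * x') y = p (x * L x') y
    obtain ⟨y₁, hy₁, -⟩ := hL x' y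
    obtain ⟨y₂, hy₂, -⟩ := hR x y
    obtain ⟨y', hy', -⟩ := hL x' y₂
    rw [← hy₁, ← hy₂, ← hL' x' y₂ y' hy', hR' x y₁ y']
    exact fun z => by rw [hy', hy₁, hy₂, mul_assoc]

end ExtendedPairing

namespace AlgebraicQuantumGroup

open RegularMultiplierHopfAlgebra

variable {A : Type*} [NonUnitalRing A] [Module ℂ A] [IsScalarTower ℂ A A] [SMulCommClass ℂ A A]
variable (G : AlgebraicQuantumGroup A)

/-! ### Actions of the dual -/

/-- `c ↦ φ(c ·)`, as an element of the dual. -/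
def leftDual : A →ₗ[ℂ] G.Dual :=
  (mulLeftFunctional G.φ).codRestrict G.dualSubmodule fun c => by
    rw [← range_mulLeftFunctional_φ]
    exact ⟨c, rfl⟩

/-- `c ↦ ψ(· c)`, as an element of the dual. -/
def rightDual : A →ₗ[ℂ] G.Dual :=
  (mulRightFunctional G.ψ).codRestrict G.dualSubmodule fun c => by
    rw [← range_mulRightFunctional_ψ]
    exact ⟨c, rfl⟩

theorem toFunctional_leftDual (c x : A) : G.toFunctional (G.leftDual c) x = G.φ (c * x) := rfl

theorem toFunctional_rightDual (c x : A) : G.toFunctional (G.rightDual c) x = G.ψ (x * c) := rfl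

theorem leftDual_surjective : Function.Surjective G.leftDual := fun b => by
  have h : G.toFunctional b ∈ G.dualSubmodule := b.2
  rw [← range_mulLeftFunctional_φ] at h
  obtain ⟨c, hc⟩ := h
  exact ⟨c, G.toFunctional_injective hc⟩

theorem rightDual_surjective : Function.Surjective G.rightDual := fun b => by
  have h : G.toFunctional b ∈ G.dualSubmodule := b.2
  rw [← range_mulRightFunctional_ψ] at h
  obtain ⟨c, hc⟩ := h
  exact ⟨c, G.toFunctional_injective hc⟩

/-- The dual separates the points of `A`. -/
theorem eq_of_toFunctional {x y : A} (h : ∀ b, G.toFunctional b x = G.toFunctional b y) :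
    x = y := by
  rw [← sub_eq_zero]
  exact G.φ_faithful fun c => by
    rw [← toFunctional_leftDual, map_sub, h, sub_self]

theorem toFunctional_dualS (a : A) (b : G.Dual) :
    G.toFunctional (G.dualS b) a = G.toFunctional b (G.S a) := G.isDualAntipode_dualS a b

theorem act_mul_right (b : G.Dual) (a t : A) :
    G.act b a * t = sliceRight (G.toFunctional b) (G.T₃ (a ⊗ₜ t)) := by
  refine G.eq_of_mul_left fun r => ?_
  change _ = LinearMap.mulLeft ℂ r _
  rw [← mul_assoc, mul_act, ← sliceRight_rTensor, mulLeft_rTensor_T₃, sliceRight_rTensor]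
  rfl

theorem act_leftDual (c a : A) : G.act (G.leftDual c) a = sliceRight G.φ (G.T₄ (c ⊗ₜ a)) := by
  refine G.eq_of_mul_left fun r => ?_
  change _ = LinearMap.mulLeft ℂ r _
  rw [mul_act, ← sliceRight_rTensor, ← mulLeft_lTensor_T₂, sliceRight_lTensor]
  rfl

/-- The right action `a ◁ b = (b ⊗ ι)Δ(a)`. -/
def ract (b : G.Dual) : A →ₗ[ℂ] A :=
  sliceLeft G.φ ∘ₗ G.T₃.toLinearMap ∘ₗ
    (TensorProduct.mk ℂ A A).flip (G.exists_repr b).choose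

theorem ract_mul_right (b : G.Dual) (a t : A) :
    G.ract b a * t = sliceLeft (G.toFunctional b) (G.T₁ (a ⊗ₜ t)) := by
  rw [← (G.exists_repr b).choose_spec]
  change LinearMap.mulRight ℂ t (sliceLeft G.φ (G.T₃ (a ⊗ₜ (G.exists_repr b).choose))) = _
  rw [← sliceLeft_lTensor, ← mulRight_rTensor_T₁, sliceLeft_rTensor]
  rfl

theorem ract_rightDual (c a : A) :
    G.ract (G.rightDual c) a = sliceLeft G.ψ (G.T₃ (a ⊗ₜ c)) := by
  refine G.eq_of_mul_right fun t => ?_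
  change _ = LinearMap.mulRight ℂ t _
  rw [ract_mul_right, ← sliceLeft_lTensor, ← mulRight_rTensor_T₁, sliceLeft_rTensor]
  rfl

/-- Both sides are (b ⊗ b')Δ(a). With associativity of B and separation of points by B, this makes A
a B-bimodule under the two actions. -/
theorem toFunctional_act (b b' : G.Dual) (a : A) :
    G.toFunctional b (G.act b' a) = G.toFunctional b' (G.ract b a) := by
  have h : G.toFunctional b (G.act b' a) = G.φ (G.act b' a * (G.exists_repr b).choose) :=
    (LinearMap.congr_fun (G.exists_repr b).choose_spec _).symm
  rw [h, act_mul_right, apply_sliceRight]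
  rfl

theorem ract_act (b b' : G.Dual) (a : A) :
    G.ract b (G.act b' a) = G.act b' (G.ract b a) := by
  refine G.eq_of_toFunctional fun c => ?_
  rw [← toFunctional_act, ← act_mul, toFunctional_act, toFunctional_mul]

theorem ract_mul (b b' : G.Dual) (a : A) : G.ract (b * b') a = G.ract b' (G.ract b a) := by
  refine G.eq_of_toFunctional fun c => ?_
  rw [← toFunctional_act, toFunctional_mul, toFunctional_act, ract_act, toFunctional_act]

theorem S_act (b : G.Dual) (a : A) : G.S (G.act (G.dualS b) a) = G.ract b (G.S a) := by
  refine G.eq_of_mul_right fun t => ?_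
  obtain ⟨t, rfl⟩ := G.S.surjective t
  rw [← S_mul, mul_act, ract_mul_right, ← flipS_T₂, sliceLeft_flipS]
  have h : G.toFunctional (G.dualS b) = G.toFunctional b ∘ₗ G.S.toLinearMap :=
    LinearMap.ext fun x => G.toFunctional_dualS x b
  rw [h]

theorem S_ract (b : G.Dual) (a : A) : G.S (G.ract (G.dualS b) a) = G.act b (G.S a) := by
  refine G.eq_of_mul_left fun t => ?_
  obtain ⟨t, rfl⟩ := G.S.surjective t
  rw [← S_mul, mul_act, ract_mul_right, ← flipS_T₁, sliceRight_flipS]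
  have h : G.toFunctional (G.dualS b) = G.toFunctional b ∘ₗ G.S.toLinearMap :=
    LinearMap.ext fun x => G.toFunctional_dualS x b
  rw [h]

/-- The functional `b(· a)` belongs to the dual. -/
theorem exists_translate_left (a : A) (b : G.Dual) :
    ∃ b' : G.Dual, ∀ x, G.toFunctional b' x = G.toFunctional b (x * a) := by
  obtain ⟨c, rfl⟩ := G.rightDual_surjective b
  exact ⟨G.rightDual (a * c), fun x => by simp only [toFunctional_rightDual, mul_assoc]⟩

/-- The functional `b(a ·)` belongs to the dual. -/
theorem exists_translate_right (a : A) (b : G.Dual) :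
    ∃ b' : G.Dual, ∀ x, G.toFunctional b' x = G.toFunctional b (a * x) := by
  obtain ⟨c, rfl⟩ := G.leftDual_surjective b
  exact ⟨G.leftDual (c * a), fun x => by simp only [toFunctional_leftDual, mul_assoc]⟩

/-- If bb' = 0 for all b', then b vanishes on all b' ▷ a, and these span A by surjectivity of the
slices of `T₄`. The other side uses a ◁ b' and `T₃`. -/
theorem nondegenerate_dual : NondegenerateProduct G.Dual := by
  constructor
  · intro b hb
    refine G.dual_ext fun a => ?_
    obtain ⟨w, rfl⟩ := ((sliceRight_surjective (V := A) G.isLeftIntegral_φ.1).comp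
      G.T₄.surjective) a
    simp only [Function.comp_apply]
    induction w with
    | zero => simp
    | add x y hx hy => simp_all
    | tmul c d =>
      rw [← act_leftDual, ← toFunctional_mul, hb]
      simp
  · intro b hb
    refine G.dual_ext fun a => ?_
    obtain ⟨w, rfl⟩ := ((sliceLeft_surjective (W := A) G.ψ_ne_zero).comp G.T₃.surjective) a
    simp only [Function.comp_apply]
    induction w with
    | zero => simp
    | add x y hx hy => simp_all
    | tmul c d =>
      rw [← ract_rightDual, ← toFunctional_act, ← toFunctional_mul, hb]
      simp

/-! ### The pairing of `B ⊗ A` with `A ⊗ B` -/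

/-- `b ⊗ x ↦ ⟨a, b⟩ x` -/
def evalFst (a : A) : G.Dual ⊗[ℂ] A →ₗ[ℂ] A := sliceLeft (G.toFunctional.flip a)

@[simp] theorem evalFst_tmul (a x : A) (b : G.Dual) :
    G.evalFst a (b ⊗ₜ x) = G.toFunctional b a • x := by simp [evalFst]

theorem tensorPairing_tmul_right (x : G.Dual ⊗[ℂ] A) (a : A) (b : G.Dual) :
    G.tensorPairing x (a ⊗ₜ b) = G.toFunctional b (G.evalFst a x) := by
  induction x with
  | zero => simp
  | add x y hx hy => simp_all
  | tmul v w => simp [tensorPairing_tmul, pair]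

/-- The test for equality in B ⊗ A used from here on: elements of B are functions on A, so an
element of B ⊗ A is a map A → A. -/
theorem eq_of_evalFst {x x' : G.Dual ⊗[ℂ] A} (h : ∀ a, G.evalFst a x = G.evalFst a x') :
    x = x' := by
  refine eq_of_rTensor (fun a : A => G.toFunctional.flip a)
    (fun b hb => G.dual_ext fun a => by simpa using hb a) fun a => ?_
  exact (TensorProduct.lid ℂ A).injective (h a)

theorem eq_zero_of_tensorPairing_left {x : G.Dual ⊗[ℂ] A} (h : ∀ y, G.tensorPairing x y = 0) :
    x = 0 :=
  G.eq_of_evalFst fun a => G.eq_of_toFunctional fun b => by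
    rw [← tensorPairing_tmul_right, h, map_zero, map_zero]

theorem eq_zero_of_tensorPairing_right {y : A ⊗[ℂ] G.Dual} (h : ∀ x, G.tensorPairing x y = 0) :
    y = 0 := by
  refine eq_of_lTensor (fun a : A => G.toFunctional.flip a)
    (fun b hb => G.dual_ext fun a => by simpa using hb a) fun a => ?_
  apply (TensorProduct.rid ℂ A).injective
  change sliceRight (G.toFunctional.flip a) y = sliceRight (G.toFunctional.flip a) 0
  refine G.eq_of_toFunctional fun b => ?_
  rw [map_zero, map_zero, ← h (b ⊗ₜ a)]
  clear h
  induction y with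
  | zero => simp
  | add x y hx hy => simp_all
  | tmul v w => simp [tensorPairing_tmul, pair, mul_comm]

theorem evalFst_mul_tmul (a a' : A) (b : G.Dual) (x : G.Dual ⊗[ℂ] A) :
    G.evalFst a' (x * b ⊗ₜ a) = G.evalFst (G.act b a') x * a := by
  induction x with
  | zero => simp
  | add x y hx hy => simp_all [add_mul]
  | tmul v w => simp [toFunctional_mul, smul_mul_assoc]

theorem evalFst_tmul_mul (a a' : A) (b : G.Dual) (x : G.Dual ⊗[ℂ] A) :
    G.evalFst a' (b ⊗ₜ a * x) = a * G.evalFst (G.ract b a') x := by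
  induction x with
  | zero => simp
  | add x y hx hy => simp_all [mul_add]
  | tmul v w => simp [toFunctional_mul, toFunctional_act, mul_smul_comm]

theorem evalFst_lTensor (f : A →ₗ[ℂ] A) (a : A) (x : G.Dual ⊗[ℂ] A) :
    G.evalFst a (f.lTensor G.Dual x) = f (G.evalFst a x) := sliceLeft_lTensor f _ x

theorem evalFst_rTensor_dualS (a : A) (x : G.Dual ⊗[ℂ] A) :
    G.evalFst a (G.dualS.toLinearMap.rTensor A x) = G.evalFst (G.S a) x := by
  induction x with
  | zero => simp
  | add x y hx hy => simp_all
  | tmul v w => simp [toFunctional_dualS]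

theorem evalFst_rTensor_mulLeft (a : A) (b : G.Dual) (x : G.Dual ⊗[ℂ] A) :
    G.evalFst a ((LinearMap.mulLeft ℂ b).rTensor A x) = G.evalFst (G.ract b a) x := by
  induction x with
  | zero => simp
  | add x y hx hy => simp_all
  | tmul v w => simp [toFunctional_mul, toFunctional_act]

theorem evalFst_rTensor_mulRight (a : A) (b : G.Dual) (x : G.Dual ⊗[ℂ] A) :
    G.evalFst a ((LinearMap.mulRight ℂ b).rTensor A x) = G.evalFst (G.act b a) x := by
  induction x with
  | zero => simp
  | add x y hx hy => simp_all
  | tmul v w => simp [toFunctional_mul]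

/-- `x' ↦ ⟨x' x, y⟩` is the pairing with an element `x ▷ y`, on which `f` can be computed. -/
theorem exists_left_action (f : A ⊗[ℂ] G.Dual →ₗ[ℂ] ℂ) (L : G.Dual ⊗[ℂ] A →ₗ[ℂ] G.Dual ⊗[ℂ] A)
    (hL : ∀ b a a' (b' b'' : G.Dual), (∀ x, G.toFunctional b'' x = G.toFunctional b' (x * a)) →
      f (G.act b a' ⊗ₜ b'') = G.toFunctional b' (G.evalFst a' (L (b ⊗ₜ a))))
    (x : G.Dual ⊗[ℂ] A) (y : A ⊗[ℂ] G.Dual) :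
    ∃ y', (∀ x', G.tensorPairing x' y' = G.tensorPairing (x' * x) y) ∧
      f y' = G.tensorPairing (L x) y := by
  induction x with
  | zero => exact ⟨0, by simp, by simp⟩
  | add x₁ x₂ h₁ h₂ =>
    obtain ⟨y₁, h₁, h₁'⟩ := h₁
    obtain ⟨y₂, h₂, h₂'⟩ := h₂
    exact ⟨y₁ + y₂, fun x' => by simp [mul_add, h₁, h₂], by simp [h₁', h₂']⟩
  | tmul b a =>
    induction y with
    | zero => exact ⟨0, by simp, by simp⟩
    | add x₁ x₂ h₁ h₂ =>
      obtain ⟨y₁, h₁, h₁'⟩ := h₁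
      obtain ⟨y₂, h₂, h₂'⟩ := h₂
      exact ⟨y₁ + y₂, fun x' => by simp [h₁, h₂], by simp [h₁', h₂']⟩
    | tmul a' b' =>
      obtain ⟨b'', h⟩ := G.exists_translate_left a b'
      refine ⟨G.act b a' ⊗ₜ b'', fun x' => ?_, ?_⟩
      · rw [tensorPairing_tmul_right, tensorPairing_tmul_right, evalFst_mul_tmul, h]
      · rw [tensorPairing_tmul_right, hL b a a' b' b'' h]

/-- `x' ↦ ⟨x x', y⟩` is the pairing with an element `y ◁ x`, on which `f` can be computed. -/
theorem exists_right_action (f : A ⊗[ℂ] G.Dual →ₗ[ℂ] ℂ)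
    (R : G.Dual ⊗[ℂ] A →ₗ[ℂ] G.Dual ⊗[ℂ] A)
    (hR : ∀ b a a' (b' b'' : G.Dual), (∀ x, G.toFunctional b'' x = G.toFunctional b' (a * x)) →
      f (G.ract b a' ⊗ₜ b'') = G.toFunctional b' (G.evalFst a' (R (b ⊗ₜ a))))
    (x : G.Dual ⊗[ℂ] A) (y : A ⊗[ℂ] G.Dual) :
    ∃ y', (∀ x', G.tensorPairing x' y' = G.tensorPairing (x * x') y) ∧
      f y' = G.tensorPairing (R x) y := by
  induction x with
  | zero => exact ⟨0, by simp, by simp⟩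
  | add x₁ x₂ h₁ h₂ =>
    obtain ⟨y₁, h₁, h₁'⟩ := h₁
    obtain ⟨y₂, h₂, h₂'⟩ := h₂
    exact ⟨y₁ + y₂, fun x' => by simp [add_mul, h₁, h₂], by simp [h₁', h₂']⟩
  | tmul b a =>
    induction y with
    | zero => exact ⟨0, by simp, by simp⟩
    | add x₁ x₂ h₁ h₂ =>
      obtain ⟨y₁, h₁, h₁'⟩ := h₁
      obtain ⟨y₂, h₂, h₂'⟩ := h₂
      exact ⟨y₁ + y₂, fun x' => by simp [h₁, h₂], by simp [h₁', h₂']⟩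
    | tmul a' b' =>
      obtain ⟨b'', h⟩ := G.exists_translate_right a b'
      refine ⟨G.ract b a' ⊗ₜ b'', fun x' => ?_, ?_⟩
      · rw [tensorPairing_tmul_right, tensorPairing_tmul_right, evalFst_tmul_mul, h]
      · rw [tensorPairing_tmul_right, hR b a a' b' b'' h]

theorem isExtendedPairing_unique {f : A ⊗[ℂ] G.Dual →ₗ[ℂ] ℂ}
    {m n : MultiplierAlgebra (G.Dual ⊗[ℂ] A)} (hm : IsExtendedPairing G.tensorPairing m f)
    (hn : IsExtendedPairing G.tensorPairing n f) : m = n :=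
  hm.unique (fun _ h => G.eq_zero_of_tensorPairing_left h)
    (fun x y => (G.exists_left_action 0 0 (by simp) x y).imp fun _ h => h.1)
    (fun x y => (G.exists_right_action 0 0 (by simp) x y).imp fun _ h => h.1) hn

/-! ### The duality -/

theorem evalFst_map_leftDual (a' : A) (z : A ⊗[ℂ] A) :
    G.evalFst a' (TensorProduct.map G.leftDual G.S.toLinearMap (TensorProduct.comm ℂ A A z))
      = G.S (sliceRight G.φ ((LinearMap.mulRight ℂ a').lTensor A z)) := by
  induction z with
  | zero => simp
  | add x y hx hy => simp_all
  | tmul v w => simp [toFunctional_leftDual]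

theorem evalFst_map_rightDual (a' : A) (z : A ⊗[ℂ] A) :
    G.evalFst a' (TensorProduct.map G.rightDual G.S.toLinearMap z)
      = G.S (sliceLeft G.ψ ((LinearMap.mulLeft ℂ a').rTensor A z)) := by
  induction z with
  | zero => simp
  | add x y hx hy => simp_all
  | tmul v w => simp [toFunctional_rightDual]

/-- The slice at a' is φ(c₂a')S(c₁)a, which the antipode formula turns into a'₁φ(ca'₂)a. The right
formula follows likewise from ψ(a'c₁)S(c₂) = ψ(a'₁c)a'₂. -/
theorem evalFst_left_formula (a a' c : A) :
    G.evalFst a' (TensorProduct.map G.leftDual G.S.toLinearMap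
      (TensorProduct.comm ℂ A A (G.T₂ (G.S.symm a ⊗ₜ c)))) = G.act (G.leftDual c) a' * a := by
  rw [evalFst_map_leftDual, ← mulLeft_rTensor_T₁, sliceRight_rTensor, LinearMap.mulLeft_apply,
    S_mul, S_sliceRight_T₁, act_leftDual, LinearEquiv.apply_symm_apply]

theorem evalFst_right_formula (a a' c : A) :
    G.evalFst a' (TensorProduct.map G.rightDual G.S.toLinearMap (G.T₁ (c ⊗ₜ G.S.symm a)))
      = a * G.ract (G.rightDual c) a' := by
  rw [evalFst_map_rightDual, mulLeft_rTensor_T₁, sliceLeft_lTensor, LinearMap.mulRight_apply,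
    S_mul, S_sliceLeft_T₂, ract_rightDual, LinearEquiv.apply_symm_apply]

theorem exists_isDuality : ∃ V : MultiplierAlgebra (G.Dual ⊗[ℂ] A), G.IsDuality V ∧
    (∀ b a a', G.evalFst a' (left V (b ⊗ₜ a)) = G.act b a' * a) ∧
    (∀ b a a', G.evalFst a' (right V (b ⊗ₜ a)) = a * G.ract b a') := by
  -- Linear sections of c ↦ φ(c ·) and c ↦ ψ(· c) turn the explicit formulas into linear maps on B ⊗
  -- A; the slices show that the choice of sections is immaterial.
  obtain ⟨s, hs⟩ := G.leftDual.exists_rightInverse_of_surjective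
    (LinearMap.range_eq_top.2 G.leftDual_surjective)
  obtain ⟨r, hr⟩ := G.rightDual.exists_rightInverse_of_surjective
    (LinearMap.range_eq_top.2 G.rightDual_surjective)
  let L : G.Dual ⊗[ℂ] A →ₗ[ℂ] G.Dual ⊗[ℂ] A :=
    TensorProduct.map G.leftDual G.S.toLinearMap ∘ₗ (TensorProduct.comm ℂ A A).toLinearMap ∘ₗ
      G.T₂.toLinearMap ∘ₗ (TensorProduct.comm ℂ A A).toLinearMap ∘ₗ
      TensorProduct.map s G.S.symm.toLinearMap
  let R : G.Dual ⊗[ℂ] A →ₗ[ℂ] G.Dual ⊗[ℂ] A :=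
    TensorProduct.map G.rightDual G.S.toLinearMap ∘ₗ G.T₁.toLinearMap ∘ₗ
      TensorProduct.map r G.S.symm.toLinearMap
  have hL : ∀ b a a', G.evalFst a' (L (b ⊗ₜ a)) = G.act b a' * a := fun b a a' =>
    (G.evalFst_left_formula a a' (s b)).trans
      (by rw [show G.leftDual (s b) = b from LinearMap.congr_fun hs b])
  have hR : ∀ b a a', G.evalFst a' (R (b ⊗ₜ a)) = a * G.ract b a' := fun b a a' =>
    (G.evalFst_right_formula a a' (r b)).trans
      (by rw [show G.rightDual (r b) = b from LinearMap.congr_fun hr b])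
  obtain ⟨V, hV, hVL, hVR⟩ := exists_isExtendedPairing
    (fun _ h => G.eq_zero_of_tensorPairing_left h) (fun _ h => G.eq_zero_of_tensorPairing_right h)
    G.evaluation L R
    (G.exists_left_action _ _ fun b a a' b' b'' h => by rw [hL, ← h]; rfl)
    (G.exists_right_action _ _ fun b a a' b' b'' h => by rw [hR, ← h]; rfl)
  exact ⟨V, hV, fun b a a' => by rw [hVL, hL], fun b a a' => by rw [hVR, hR]⟩

section Duality

variable {G} {V : MultiplierAlgebra (G.Dual ⊗[ℂ] A)} (hV : G.IsDuality V)
include hV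

theorem IsDuality.evalFst_left (b : G.Dual) (a a' : A) :
    G.evalFst a' (left V (b ⊗ₜ a)) = G.act b a' * a := by
  obtain ⟨V', hV', h, -⟩ := G.exists_isDuality
  rw [G.isExtendedPairing_unique hV hV', h]

theorem IsDuality.evalFst_right (b : G.Dual) (a a' : A) :
    G.evalFst a' (right V (b ⊗ₜ a)) = a * G.ract b a' := by
  obtain ⟨V', hV', -, h⟩ := G.exists_isDuality
  rw [G.isExtendedPairing_unique hV hV', h]

theorem IsDuality.leftFormula : G.LeftFormula V := by
  intro a c b hb
  obtain rfl : b = G.leftDual c := G.toFunctional_injective hb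
  have h : left V (G.leftDual c ⊗ₜ a) = TensorProduct.map G.leftDual G.S.toLinearMap
      (TensorProduct.comm ℂ A A (G.T₂ (G.S.symm a ⊗ₜ c))) :=
    G.eq_of_evalFst fun a' => by rw [hV.evalFst_left, evalFst_left_formula]
  rw [h, ← LinearMap.comp_apply, LinearMap.rTensor_comp_map]
  rfl

theorem IsDuality.rightFormula : G.RightFormula V := by
  intro a c b hb
  obtain rfl : b = G.rightDual c := G.toFunctional_injective hb
  have h : right V (G.rightDual c ⊗ₜ a) = TensorProduct.map G.rightDual G.S.toLinearMap
      (G.T₁ (c ⊗ₜ G.S.symm a)) :=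
    G.eq_of_evalFst fun a' => by rw [hV.evalFst_right, evalFst_right_formula]
  rw [h, ← LinearMap.comp_apply, LinearMap.rTensor_comp_map]
  rfl

end Duality

/-! ### The elements (1 ⊗ a)V(b ⊗ 1) and (b ⊗ 1)V(1 ⊗ a). -/

/-- A linear map on `B ⊗ A` with values `φ(c₂ ·) ⊗ a S(c₁)` on `φ(c ·) ⊗ a`. -/
theorem exists_inr_mul_inl : ∃ X : G.Dual ⊗[ℂ] A →ₗ[ℂ] G.Dual ⊗[ℂ] A,
    ∀ b a a', G.evalFst a' (X (b ⊗ₜ a)) = a * G.act b a' := by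
  obtain ⟨s, hs⟩ := G.leftDual.exists_rightInverse_of_surjective
    (LinearMap.range_eq_top.2 G.leftDual_surjective)
  refine ⟨TensorProduct.map G.leftDual G.S.toLinearMap ∘ₗ (TensorProduct.comm ℂ A A).toLinearMap ∘ₗ
    G.T₃.toLinearMap ∘ₗ TensorProduct.map s G.S.symm.toLinearMap, fun b a a' => ?_⟩
  refine (G.evalFst_map_leftDual a' (G.T₃ (s b ⊗ₜ G.S.symm a))).trans ?_
  rw [← mulRight_rTensor_T₁, sliceRight_rTensor, LinearMap.mulRight_apply, S_mul,
    S_sliceRight_T₁, ← act_leftDual, LinearEquiv.apply_symm_apply,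
    show G.leftDual (s b) = b from LinearMap.congr_fun hs b]

/-- A linear map on `B ⊗ A` with values `ψ(· c₁) ⊗ S(c₂) a` on `ψ(· c) ⊗ a`. -/
theorem exists_inl_mul_inr : ∃ Y : G.Dual ⊗[ℂ] A →ₗ[ℂ] G.Dual ⊗[ℂ] A,
    ∀ b a a', G.evalFst a' (Y (b ⊗ₜ a)) = G.ract b a' * a := by
  obtain ⟨r, hr⟩ := G.rightDual.exists_rightInverse_of_surjective
    (LinearMap.range_eq_top.2 G.rightDual_surjective)
  refine ⟨TensorProduct.map G.rightDual G.S.toLinearMap ∘ₗ G.T₄.toLinearMap ∘ₗ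
    (TensorProduct.comm ℂ A A).toLinearMap ∘ₗ TensorProduct.map r G.S.symm.toLinearMap,
    fun b a a' => ?_⟩
  refine (G.evalFst_map_rightDual a' (G.T₄ (G.S.symm a ⊗ₜ r b))).trans ?_
  rw [← mulLeft_lTensor_T₂, sliceLeft_lTensor, LinearMap.mulLeft_apply, S_mul,
    S_sliceLeft_T₂, ← ract_rightDual, LinearEquiv.apply_symm_apply,
    show G.rightDual (r b) = b from LinearMap.congr_fun hr b]

section Duality

variable {G} {V : MultiplierAlgebra (G.Dual ⊗[ℂ] A)} (hV : G.IsDuality V)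
include hV

/-- An element with the slices of `(1 ⊗ a)V(b ⊗ 1)` is equal to it. -/
theorem IsDuality.embed_eq_inr_mul_inl {b : G.Dual} {a : A} {x : G.Dual ⊗[ℂ] A}
    (hx : ∀ a', G.evalFst a' x = a * G.act b a') : embed x = inr a * V * inl b := by
  ext z
  · rw [left_embed, left_mul_apply, left_mul_apply, left_inl, left_inr]
    refine G.eq_of_evalFst fun a' => ?_
    rw [evalFst_lTensor]
    induction z with
    | zero => simp
    | add y z hy hz => simp_all [mul_add]
    | tmul b₁ a₁ =>
      rw [LinearMap.rTensor_tmul, LinearMap.mulLeft_apply, LinearMap.mulLeft_apply,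
        hV.evalFst_left, evalFst_mul_tmul, hx, act_mul, mul_assoc]
  · rw [right_embed, right_mul_apply, right_mul_apply, right_inl, right_inr]
    refine G.eq_of_evalFst fun a' => ?_
    rw [evalFst_rTensor_mulRight]
    induction z with
    | zero => simp
    | add y z hy hz => simp_all [add_mul]
    | tmul b₁ a₁ =>
      rw [LinearMap.lTensor_tmul, LinearMap.mulRight_apply, hV.evalFst_right, evalFst_tmul_mul, hx,
        ract_act, mul_assoc]

/-- An element with the slices of `(b ⊗ 1)V(1 ⊗ a)` is equal to it. -/
theorem IsDuality.embed_eq_inl_mul_inr {b : G.Dual} {a : A} {x : G.Dual ⊗[ℂ] A}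
    (hx : ∀ a', G.evalFst a' x = G.ract b a' * a) : embed x = inl b * V * inr a := by
  ext z
  · rw [left_embed, left_mul_apply, left_mul_apply, left_inl, left_inr]
    refine G.eq_of_evalFst fun a' => ?_
    rw [evalFst_rTensor_mulLeft]
    induction z with
    | zero => simp
    | add y z hy hz => simp_all [mul_add]
    | tmul b₁ a₁ =>
      rw [LinearMap.lTensor_tmul, LinearMap.mulLeft_apply, hV.evalFst_left, evalFst_mul_tmul, hx,
        ract_act, mul_assoc]
  · rw [right_embed, right_mul_apply, right_mul_apply, right_inl, right_inr]
    refine G.eq_of_evalFst fun a' => ?_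
    rw [evalFst_lTensor]
    induction z with
    | zero => simp
    | add y z hy hz => simp_all [add_mul]
    | tmul b₁ a₁ =>
      rw [LinearMap.rTensor_tmul, LinearMap.mulRight_apply, LinearMap.mulRight_apply,
        hV.evalFst_right, evalFst_tmul_mul, hx, ract_mul, mul_assoc]

end Duality

/-! ### The multipliers (ι ⊗ S)V and (S ⊗ ι)V. -/

/-- The multiplier `(ι ⊗ S)V = (S ⊗ ι)V`. -/
theorem exists_antipode_duality : ∃ W : MultiplierAlgebra (G.Dual ⊗[ℂ] A),
    IsExtendedPairing G.tensorPairing W (G.evaluation ∘ₗ G.dualS.toLinearMap.lTensor A) ∧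
    (∀ b a a', G.evalFst a' (left W (b ⊗ₜ a)) = G.S (G.act b a') * a) ∧
    (∀ b a a', G.evalFst a' (right W (b ⊗ₜ a)) = a * G.S (G.ract b a')) := by
  obtain ⟨X, hX⟩ := G.exists_inr_mul_inl
  obtain ⟨Y, hY⟩ := G.exists_inl_mul_inr
  -- The defining equations for (ι ⊗ S)V force these maps; S reverses products, so a(b ▷ a') becomes
  -- S(b ▷ a')S(a).
  let L : G.Dual ⊗[ℂ] A →ₗ[ℂ] G.Dual ⊗[ℂ] A :=
    G.S.toLinearMap.lTensor G.Dual ∘ₗ X ∘ₗ G.S.symm.toLinearMap.lTensor G.Dual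
  let R : G.Dual ⊗[ℂ] A →ₗ[ℂ] G.Dual ⊗[ℂ] A :=
    G.S.toLinearMap.lTensor G.Dual ∘ₗ Y ∘ₗ G.S.symm.toLinearMap.lTensor G.Dual
  have hL : ∀ b a a', G.evalFst a' (L (b ⊗ₜ a)) = G.S (G.act b a') * a := fun b a a' => by
    simp [L, evalFst_lTensor, hX, S_mul]
  have hR : ∀ b a a', G.evalFst a' (R (b ⊗ₜ a)) = a * G.S (G.ract b a') := fun b a a' => by
    simp [R, evalFst_lTensor, hY, S_mul]
  have hf : ∀ a b, (G.evaluation ∘ₗ G.dualS.toLinearMap.lTensor A) (a ⊗ₜ b)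
      = G.toFunctional b (G.S a) := fun a b => G.toFunctional_dualS a b
  obtain ⟨W, hW, hWL, hWR⟩ := exists_isExtendedPairing
    (fun _ h => G.eq_zero_of_tensorPairing_left h) (fun _ h => G.eq_zero_of_tensorPairing_right h)
    (G.evaluation ∘ₗ G.dualS.toLinearMap.lTensor A) L R
    (G.exists_left_action _ _ fun b a a' b' b'' h => by rw [hL, ← h, hf])
    (G.exists_right_action _ _ fun b a a' b' b'' h => by rw [hR, ← h, hf])
  exact ⟨W, hW, fun b a a' => by rw [hWL, hL], fun b a a' => by rw [hWR, hR]⟩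

theorem evaluation_comp_rTensor_S :
    G.evaluation ∘ₗ G.S.toLinearMap.rTensor G.Dual
      = G.evaluation ∘ₗ G.dualS.toLinearMap.lTensor A := by
  refine TensorProduct.ext' fun a b => ?_
  exact (G.toFunctional_dualS a b).symm

theorem embed_dual_injective : Function.Injective
    (embed : G.Dual ⊗[ℂ] A → MultiplierAlgebra (G.Dual ⊗[ℂ] A)) :=
  embed_injective (G.nondegenerate_dual.tensor G.nondegenerate)

section Duality

variable {G} {V W : MultiplierAlgebra (G.Dual ⊗[ℂ] A)}

/-- The elements under the existential are unique because B ⊗ A embeds in its multiplier algebra,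
and surjectivity of S lets the equations reach every b ⊗ a. -/
theorem IsAntipodeSnd.unique {W' : MultiplierAlgebra (G.Dual ⊗[ℂ] A)} (hW : G.IsAntipodeSnd V W)
    (hW' : G.IsAntipodeSnd V W') : W = W' := by
  ext z <;> induction z with
  | zero => simp
  | add y z hy hz => simp_all
  | tmul b a =>
    obtain ⟨a, rfl⟩ := G.S.surjective a
    first
    | obtain ⟨⟨x, hx, h⟩, -⟩ := hW a b
      obtain ⟨⟨x', hx', h'⟩, -⟩ := hW' a b
      rw [h, h', G.embed_dual_injective (hx.trans hx'.symm)]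
    | obtain ⟨-, ⟨x, hx, h⟩⟩ := hW a b
      obtain ⟨-, ⟨x', hx', h'⟩⟩ := hW' a b
      rw [h, h', G.embed_dual_injective (hx.trans hx'.symm)]

theorem IsAntipodeFst.unique {W' : MultiplierAlgebra (G.Dual ⊗[ℂ] A)} (hW : G.IsAntipodeFst V W)
    (hW' : G.IsAntipodeFst V W') : W = W' := by
  ext z <;> induction z with
  | zero => simp
  | add y z hy hz => simp_all
  | tmul b a =>
    obtain ⟨b, rfl⟩ := G.dualS.surjective b
    first
    | obtain ⟨⟨x, hx, h⟩, -⟩ := hW a b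
      obtain ⟨⟨x', hx', h'⟩, -⟩ := hW' a b
      rw [h, h', G.embed_dual_injective (hx.trans hx'.symm)]
    | obtain ⟨-, ⟨x, hx, h⟩⟩ := hW a b
      obtain ⟨-, ⟨x', hx', h'⟩⟩ := hW' a b
      rw [h, h', G.embed_dual_injective (hx.trans hx'.symm)]

theorem IsDuality.exists_antipode (hV : G.IsDuality V) :
    ∃ W : MultiplierAlgebra (G.Dual ⊗[ℂ] A), G.IsAntipodeSnd V W ∧ G.IsAntipodeFst V W ∧
      IsExtendedPairing G.tensorPairing W (G.evaluation ∘ₗ G.dualS.toLinearMap.lTensor A) := by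
  obtain ⟨X, hX⟩ := G.exists_inr_mul_inl
  obtain ⟨Y, hY⟩ := G.exists_inl_mul_inr
  obtain ⟨W, hW, hL, hR⟩ := G.exists_antipode_duality
  refine ⟨W, fun a b =>
    ⟨⟨X (b ⊗ₜ a), hV.embed_eq_inr_mul_inl (hX b a), G.eq_of_evalFst fun a' => ?_⟩,
      ⟨Y (b ⊗ₜ a), hV.embed_eq_inl_mul_inr (hY b a), G.eq_of_evalFst fun a' => ?_⟩⟩,
    fun a b =>
    ⟨⟨Y (b ⊗ₜ a), hV.embed_eq_inl_mul_inr (hY b a), G.eq_of_evalFst fun a' => ?_⟩,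
      ⟨X (b ⊗ₜ a), hV.embed_eq_inr_mul_inl (hX b a), G.eq_of_evalFst fun a' => ?_⟩⟩, hW⟩
  · rw [hL, evalFst_lTensor, hX, LinearEquiv.coe_coe, S_mul]
  · rw [hR, evalFst_lTensor, hY, LinearEquiv.coe_coe, S_mul]
  -- The antipode of B moves to a' as S, and S exchanges the two actions: S(S(b) ▷ a') = S(a') ◁ b.
  -- Hence the same W satisfies the equations for (S ⊗ ι)V.
  · rw [hL, evalFst_rTensor_dualS, hY, S_act]
  · rw [hR, evalFst_rTensor_dualS, hX, S_ract]

end Duality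

end AlgebraicQuantumGroup
end

theorem proposition3p8 {A : Type*} [NonUnitalRing A] [Module ℂ A] [IsScalarTower ℂ A A]
    [SMulCommClass ℂ A A] (G : AlgebraicQuantumGroup A) :
    -- the objects entering the statement are the ones they are meant to be
    (G.IsAntipode G.S ∧ G.IsRightIntegral G.ψ ∧ G.IsDualAntipode G.dualS ∧
      LinearMap.range (AlgebraicQuantumGroup.mulLeftFunctional G.φ) = G.dualSubmodule ∧
      LinearMap.range (AlgebraicQuantumGroup.mulRightFunctional G.ψ) = G.dualSubmodule) ∧
    -- existence and uniqueness of the duality, and its explicit form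
    (∃! V : MultiplierAlgebra (G.Dual ⊗[ℂ] A), G.IsDuality V) ∧
    ∀ V : MultiplierAlgebra (G.Dual ⊗[ℂ] A), G.IsDuality V →
      G.LeftFormula V ∧ G.RightFormula V ∧
      (∃! W : MultiplierAlgebra (G.Dual ⊗[ℂ] A), G.IsAntipodeSnd V W) ∧
      (∃! W : MultiplierAlgebra (G.Dual ⊗[ℂ] A), G.IsAntipodeFst V W) ∧
      (∀ W : MultiplierAlgebra (G.Dual ⊗[ℂ] A), G.IsAntipodeSnd V W →
        IsExtendedPairing G.tensorPairing W
          (G.evaluation ∘ₗ G.dualS.toLinearMap.lTensor A)) ∧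
      (∀ W : MultiplierAlgebra (G.Dual ⊗[ℂ] A), G.IsAntipodeFst V W →
        IsExtendedPairing G.tensorPairing W
          (G.evaluation ∘ₗ G.S.toLinearMap.rTensor G.Dual)) := by
  refine ⟨⟨G.isAntipode_S, G.isRightIntegral_ψ, G.isDualAntipode_dualS,
    G.range_mulLeftFunctional_φ, G.range_mulRightFunctional_ψ⟩, ?_, fun V hV => ?_⟩
  · obtain ⟨V, hV, -⟩ := G.exists_isDuality
    exact ⟨V, hV, fun V' hV' => G.isExtendedPairing_unique hV' hV⟩
  · obtain ⟨W, hSnd, hFst, hW⟩ := hV.exists_antipode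
    refine ⟨hV.leftFormula, hV.rightFormula, ⟨W, hSnd, fun W' h => h.unique hSnd⟩,
      ⟨W, hFst, fun W' h => h.unique hFst⟩, fun W' h => ?_, fun W' h => ?_⟩
    · rwa [h.unique hSnd]
    · rwa [h.unique hFst, G.evaluation_comp_rTensor_S]
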